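/- Setting. Let $\Gamma$ be an oriented multigraph (loops and multiple edges allowed; $\Gamma$ may be infinite) with vertex set $V$, edge set $E$, and all vertex degrees at most $k$. To each $v\in V$ attach a Riemann sphere $S_v=\mathbb C\cup\{\infty\}$ with standard coordinate $z$. For each edge $e$ from $v$ to $v'$ let $p_e^-\in D_e^-\subset S_v$ and $p_e^+\in D_e^+\subset S_{v'}$, and let $z_e^\pm:D_e^\pm\to D(0,\rho)$ be biholomorphic with $z_e^\pm(p_e^\pm)=0$. Assume that these coordinates are admissible with constants $\rho,c_1,c_2>0$: the points $p_e^\pm$ are finite, the disks $D_e^\pm$ lying in the same sphere are pairwise disjoint, and $c_1|z_e^\pm(z)|\le|z-p_e^\pm|\le c_2|z_e^\pm(z)|$ on $D_e^\pm$. For $\mathbf t=(t_e)_{e\in E}\in\ell^\infty(E)$ with $|t_e|<\rho^2$, let $\Sigma_{\mathbf t}$ be the (possibly noded) Riemann surface obtained by opening nodes: if $t_e\ne0$, remove $|z_e^\pm|\le|t_e|/\rho$ and identify $z\in D_e^-$ with $z'\in D_e^+$ when $z_e^-(z)\,z_e^+(z')=t_e$; if $t_e=0$, identify $p_e^-$ with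 $p_e^+$. Let $\gamma_e$ be the homology class of $\partial D_e^+$. A regular differential on $\Sigma_{\mathbf t}$ is a differential which is holomorphic away from the nodes and has at most simple poles, with opposite residues, at the two sides of each node. For $0<\eta\le\rho c_1$, let $\mathcal H^1_\infty(\Sigma_{\mathbf t})$ be the space of regular differentials $\omega$ such that $|\omega/dz|$ is bounded, uniformly in $v\in V$, on the part of $S_v$ outside the disks $D(p_e^\pm,\eta)$. Statement. For all $k\in\mathbb N$ and $\rho,c_1,c_2>0$ there are constants $C>0$ and $\delta>0$, depending only on $k,\rho,c_1,c_2$, such that the following holds for all data as above with $\|\mathbf t\|_\infty<\delta$, all $\eta\in(0,\rho c_1]$, and every $\omega\in\mathcal H^1_\infty(\Sigma_{\mathbf t})$ with periods $\int_{\gamma_e}\omega=\alpha_e$ $(e\in E)$, $\alpha=(\alpha_e)\in\ell^\infty(E)$. (i) For every edge $e$ (away from $p_e^\pm$ if $t_e=0$), $$\left|2\pi i\,\frac{\omega}{dz}\mp\frac{\alpha_e}{z-p_e^\pm}\right|\le C\|\alpha\|_\infty\quad\text{on } \{z\in D_e^\pm:\ |t_e|^{1/2}\le|z_e^\pm(z)|\}.$$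 (ii) With the same constant $C$: for every $\epsilon\in(0,c_1\rho)$ and every edge $e\in E$, if $|\alpha_e|>C\epsilon\|\alpha\|_\infty$, then $\omega$ has no zero in the closed neck annulus of $\Sigma_{\mathbf t}$ bounded by the circles $C(p_e^-,\epsilon)$ and $C(p_e^+,\epsilon)$, that is, in the set of points of the neck of $e$ whose position in $D_e^-$ (if any) is at distance at most $\epsilon$ from $p_e^-$ and whose position in $D_e^+$ (if any) is at distance at most $\epsilon$ from $p_e^+$. If $t_e=0$, this set consists of two closed disks joined at a node, and the claim is about its points other than the node. -/

import Mathlib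

universe u w

open Filter Topology

namespace OpeningNodes

/-- An oriented multigraph with vertex set `V` and edge set `E`; loops and multiple edges are
allowed. The edge `e` goes from `src e` to `tgt e`. -/
structure OrientedMultigraph (V E : Type*) where
  src : E → V
  tgt : E → V

/-- The end of an edge that carries the sign `-` (`false`, the starting point)
or `+` (`true`, the endpoint). -/
def OrientedMultigraph.vert {V E : Type*} (Γ : OrientedMultigraph V E) (h : E × Bool) : V :=
  bif h.2 then Γ.tgt h.1 else Γ.src h.1

/-- Every vertex has at most `k` adjacent edges. -/
def OrientedMultigraph.DegreeLE {V E : Type*} (Γ : OrientedMultigraph V E) (k : ℕ) : Prop :=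
  ∀ v : V, {e : E | Γ.src e = v ∨ Γ.tgt e = v}.encard ≤ k

/-- Admissible coordinates with constants `ρ, c₁, c₂` on the Riemann spheres `S_v` (one copy of
`ℂ ∪ {∞}` for each vertex). Half-edges are indexed by `E × Bool`: `(e, false)` stands for the
data `p_e^-, D_e^-, z_e^-` in the sphere of the starting point of `e`, and `(e, true)` for
`p_e^+, D_e^+, z_e^+` in the sphere of its endpoint. The disk `D_e^±` is the source of the
coordinate `z_e^±`. -/
structure AdmissibleCoordinates {V E : Type*} (Γ : OrientedMultigraph V E) (ρ c₁ c₂ : ℝ) where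
  p : E × Bool → ℂ
  coord : E × Bool → OpenPartialHomeomorph ℂ ℂ
  coord_target : ∀ h, (coord h).target = Metric.ball 0 ρ
  coord_holo : ∀ h, DifferentiableOn ℂ (coord h) (coord h).source
  coord_symm_holo : ∀ h, DifferentiableOn ℂ (coord h).symm (coord h).target
  p_mem : ∀ h, p h ∈ (coord h).source
  coord_p : ∀ h, coord h (p h) = 0
  disjoint : ∀ h h', h ≠ h' → Γ.vert h = Γ.vert h' →
    Disjoint (coord h).source (coord h').source
  lower : ∀ h, ∀ z ∈ (coord h).source, c₁ * ‖coord h z‖ ≤ ‖z - p h‖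
  upper : ∀ h, ∀ z ∈ (coord h).source, ‖z - p h‖ ≤ c₂ * ‖coord h z‖

namespace AdmissibleCoordinates

variable {V E : Type*} {Γ : OrientedMultigraph V E} {ρ c₁ c₂ : ℝ}

/-- The set `|z_e^±| ≤ |t_e| / ρ` in `D_e^±`; it is the single point `p_e^±` if `t_e = 0`. -/
def removed (A : AdmissibleCoordinates Γ ρ c₁ c₂) (t : E → ℂ) (h : E × Bool) : Set ℂ :=
  {z | z ∈ (A.coord h).source ∧ ‖A.coord h z‖ ≤ ‖t h.1‖ / ρ}

/-- The finite points of `S_v` that are kept in `Σ_t` and are not nodes. -/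
def smoothPart (A : AdmissibleCoordinates Γ ρ c₁ c₂) (t : E → ℂ) (v : V) : Set ℂ :=
  {z | ∀ h, Γ.vert h = v → z ∉ A.removed t h}

/-- The points of the disjoint union of the spheres `S_v` that are left when, for each edge `e`
with `t_e ≠ 0`, the disks `|z_e^±| ≤ |t_e| / ρ` are removed. -/
structure Pt (A : AdmissibleCoordinates Γ ρ c₁ c₂) (t : E → ℂ) where
  vertex : V
  pt : OnePoint ℂ
  kept : ∀ h, Γ.vert h = vertex → t h.1 ≠ 0 → ∀ z ∈ A.removed t h, pt ≠ (z : OnePoint ℂ)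

/-- The point `x` is the point `z` of the disk `D_e^±`. -/
def Pt.InDisk {A : AdmissibleCoordinates Γ ρ c₁ c₂} {t : E → ℂ} (x : A.Pt t) (h : E × Bool)
    (z : ℂ) : Prop :=
  x.vertex = Γ.vert h ∧ x.pt = (z : OnePoint ℂ) ∧ z ∈ (A.coord h).source

/-- The identifications: if `t_e ≠ 0` then `z ∈ D_e^-` is identified with `z' ∈ D_e^+` when
`z_e^-(z) z_e^+(z') = t_e`; if `t_e = 0` then `p_e^-` is identified with `p_e^+`. -/
def Glue (A : AdmissibleCoordinates Γ ρ c₁ c₂) (t : E → ℂ) (x y : A.Pt t) : Prop :=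
  ∃ (e : E) (z z' : ℂ), x.InDisk (e, false) z ∧ y.InDisk (e, true) z' ∧
    ((t e ≠ 0 ∧ A.coord (e, false) z * A.coord (e, true) z' = t e) ∨
      (t e = 0 ∧ z = A.p (e, false) ∧ z' = A.p (e, true)))

/-- The (possibly noded) surface `Σ_t`, as the quotient by the equivalence relation generated by
the identifications. -/
def Surface (A : AdmissibleCoordinates Γ ρ c₁ c₂) (t : E → ℂ) : Type _ :=
  Quot (A.Glue t)

/-- The class in `Σ_t` of a point of one of the spheres. -/
def toSurface (A : AdmissibleCoordinates Γ ρ c₁ c₂) (t : E → ℂ) (x : A.Pt t) : A.Surface t :=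
  Quot.mk _ x

/-- The closed annulus bounded in `Σ_t` by the circles `C(p_e^-, ε)` and `C(p_e^+, ε)`: the points
of the neck (the image of `D_e^-` and `D_e^+`) whose position in `D_e^-` is at distance at most
`ε` from `p_e^-` and whose position in `D_e^+` is at distance at most `ε` from `p_e^+`.
(If `t_e = 0`, a point of the neck other than the node lies in only one of the two disks, and
the set consists of the two closed disks of radius `ε` joined at the node.) -/
def neckAnnulus (A : AdmissibleCoordinates Γ ρ c₁ c₂) (t : E → ℂ) (e : E) (ε : ℝ) :
    Set (A.Surface t) :=
  {q | (∃ (s : Bool) (x : A.Pt t) (z : ℂ), x.InDisk (e, s) z ∧ A.toSurface t x = q) ∧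
    ∀ (s : Bool) (x : A.Pt t) (z : ℂ), x.InDisk (e, s) z → A.toSurface t x = q →
      ‖z - A.p (e, s)‖ ≤ ε}

/-- The change of coordinates `φ_e^+ = (z_e^+)⁻¹ ∘ (t_e / z_e^-)` on the neck of `e`. -/
noncomputable def transition (A : AdmissibleCoordinates Γ ρ c₁ c₂) (t : E → ℂ) (e : E) (z : ℂ) :
    ℂ :=
  (A.coord (e, true)).symm (t e / A.coord (e, false) z)

/-- A regular differential `ω` on `Σ_t`, written `ω = f_v dz` in the standard coordinate `z` of
each sphere `S_v`. Only the values of `f_v` on `smoothPart t v` are relevant. -/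
structure RegularDifferential (A : AdmissibleCoordinates Γ ρ c₁ c₂) (t : E → ℂ) where
  f : V → ℂ → ℂ
  /-- `ω` is holomorphic at the finite points which are not nodes, -/
  holo : ∀ v, DifferentiableOn ℂ (f v) (A.smoothPart t v)
  /-- and at infinity: in the coordinate `w = 1/z` it is `-f_v(1/w) w⁻² dw`. -/
  holo_infty : ∀ v, ∃ g : ℂ → ℂ, AnalyticAt ℂ g 0 ∧
    ∀ᶠ w in 𝓝[≠] (0 : ℂ), -(f v w⁻¹ * (w ^ 2)⁻¹) = g w
  /-- The expressions of `ω` on the two sides of a neck agree: `(φ_e^+)^* ω = ω`. -/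
  glue : ∀ e, t e ≠ 0 → ∀ z ∈ (A.coord (e, false)).source,
    ‖t e‖ / ρ < ‖A.coord (e, false) z‖ →
      f (Γ.tgt e) (A.transition t e z) * deriv (A.transition t e) z = f (Γ.src e) z
  /-- At a node, `ω` has (at most) simple poles with opposite residues. -/
  node : ∀ e, t e = 0 → ∃ c : ℂ,
    Tendsto (fun z => (z - A.p (e, true)) * f (Γ.tgt e) z) (𝓝[≠] A.p (e, true)) (𝓝 c) ∧
    Tendsto (fun z => (z - A.p (e, false)) * f (Γ.src e) z) (𝓝[≠] A.p (e, false)) (𝓝 (-c))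

namespace RegularDifferential

variable {A : AdmissibleCoordinates Γ ρ c₁ c₂} {t : E → ℂ}

/-- The norm `sup_v sup_{Ω_{v,η}} |ω/dz|` is finite, where `Ω_{v,η}` is `S_v` minus the disks
`D(p_e^±, η)`; that is, `ω` belongs to the space `H^1_∞(Σ_t)`. (At infinity `ω/dz` is zero.) -/
def FiniteNorm (ω : A.RegularDifferential t) (η : ℝ) : Prop :=
  ∃ M : ℝ, ∀ v, ∀ z ∈ A.smoothPart t v,
    (∀ h, Γ.vert h = v → η ≤ ‖z - A.p h‖) → ‖ω.f v z‖ ≤ M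

/-- The period `∫_{γ_e} ω`. The class `γ_e` of `∂D_e^+` is represented by the curve
`|z_e^+| = r`, oriented positively, with `r = (ρ + |t_e|/ρ) / 2` between `|t_e|/ρ` and `ρ`;
the integral is written in the coordinate `w = z_e^+`. -/
noncomputable def period (ω : A.RegularDifferential t) (e : E) : ℂ :=
  ∮ w in C(0, (ρ + ‖t e‖ / ρ) / 2),
    ω.f (Γ.tgt e) ((A.coord (e, true)).symm w) * deriv (A.coord (e, true)).symm w

/-- `ω` vanishes at a point of one of the spheres, other than a node. -/
def VanishesAt (ω : A.RegularDifferential t) (x : A.Pt t) : Prop :=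
  (∃ z : ℂ, x.pt = (z : OnePoint ℂ) ∧ z ∈ A.smoothPart t x.vertex ∧ ω.f x.vertex z = 0) ∨
  (x.pt = OnePoint.infty ∧
    Tendsto (fun w : ℂ => -(ω.f x.vertex w⁻¹ * (w ^ 2)⁻¹)) (𝓝[≠] 0) (𝓝 0))

/-- The zeros of `ω` in `Σ_t`. -/
def zeros (ω : A.RegularDifferential t) : Set (A.Surface t) :=
  {q | ∃ x : A.Pt t, A.toSurface t x = q ∧ ω.VanishesAt x}

end RegularDifferential

end AdmissibleCoordinates

end OpeningNodes

/-! ### Cauchy integrals over circles and annuli; splitting off singular parts. -/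

section ComplexAnalysis

open Metric Complex

/-! On a sphere `S_v` write ω = f dz. Since f vanishes at infinity, Liouville's theorem makes 2πi f
the sum of its singular parts in the disks at v (`eq_sum_singularPart`). The singular part in the
disk of a half-edge h is a Cauchy integral over a small circle around `p h`. The gluing w ↦ t/w
turns it into an integral over the fixed circle |w| = r on the other side of the neck, with kernel
1/(z - ψ(t/w)), ψ being the inverse coordinate of h. This form also covers t = 0, where it is the
simple pole.

As ψ(t/w) is within c₂|t|/r of `p h`, replacing it by `p h` gives ±α/(z - p), with an error of order
|t| X / |z - p|², where X bounds ω on the opposite circle |w| = r (`norm_singularPart_sub_le`). On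
the circles |w| = r this gives X ≤ const·‖α‖ + X/2 for small t (`norm_pull_le_of_norm_pull_le`),
hence X ≤ const·‖α‖, provided that X is finite. Finiteness is a real issue when the graph is
infinite: it comes from the finite norm of ω, by the maximum principle and a bootstrap between the
two ends of each edge (`FiniteNorm.exists_bound_pull`).

Where |z_e| ≥ |t|^{1/2}, the quantity |t|/|z - p|² is at most 1/c₁², so the error is O(‖α‖): this is
(i) (`FiniteNorm.norm_sub_le`). For (ii), the two coordinates of a neck point multiply to t, so one
of them has modulus at least |t|^{1/2}. At a zero the estimate on that side gives |α_e| ≤ C ε ‖α‖.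
-/

/-- Differentiation under the integral: near z₀ the denominator stays away from 0 uniformly on the
circle. The pole γ(w) is left general because it will be ψ(w) or ψ(t/w). -/
theorem differentiableOn_circleIntegral_div_sub {a γ : ℂ → ℂ} {c : ℂ} {R : ℝ} (hR : 0 ≤ R)
    (ha : ContinuousOn a (sphere c R)) (hγ : ContinuousOn γ (sphere c R)) {U : Set ℂ}
    (hU : IsOpen U) (hγU : ∀ w ∈ sphere c R, γ w ∉ U) :
    DifferentiableOn ℂ (fun z => ∮ w in C(c, R), a w / (z - γ w)) U := by
  have hmem : ∀ θ, circleMap c R θ ∈ sphere c R := circleMap_mem_sphere c hR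
  have hac : Continuous fun θ : ℝ => a (circleMap c R θ) :=
    ha.comp_continuous (continuous_circleMap c R) hmem
  have hγc : Continuous fun θ : ℝ => γ (circleMap c R θ) :=
    hγ.comp_continuous (continuous_circleMap c R) hmem
  have hdc : Continuous fun θ : ℝ => deriv (circleMap c R) θ := by
    simp only [deriv_circleMap]
    fun_prop
  intro z₀ hz₀
  obtain ⟨ε, hε, hball⟩ := Metric.isOpen_iff.1 hU z₀ hz₀
  have hfar : ∀ θ, ∀ z ∈ ball z₀ (ε / 2), ε / 2 ≤ ‖z - γ (circleMap c R θ)‖ := by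
    intro θ z hz
    have h1 : ε ≤ ‖γ (circleMap c R θ) - z₀‖ := by
      by_contra! hlt
      exact hγU _ (hmem θ) (hball (by simpa [dist_eq_norm] using hlt))
    have h2 : ‖z - z₀‖ < ε / 2 := by simpa [dist_eq_norm] using hz
    have h3 : ‖γ (circleMap c R θ) - z₀‖ ≤ ‖z - γ (circleMap c R θ)‖ + ‖z - z₀‖ := by
      rw [norm_sub_rev z]
      exact norm_sub_le_norm_sub_add_norm_sub _ _ _
    linarith
  have hne : ∀ θ, ∀ z ∈ ball z₀ (ε / 2), z - γ (circleMap c R θ) ≠ 0 := fun θ z hz =>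
    norm_pos_iff.1 ((half_pos hε).trans_le (hfar θ z hz))
  have hcont : ∀ z ∈ ball z₀ (ε / 2), Continuous fun θ : ℝ =>
      deriv (circleMap c R) θ • (a (circleMap c R θ) / (z - γ (circleMap c R θ))) :=
    fun z hz => hdc.smul (hac.div (continuous_const.sub hγc) fun θ => hne θ z hz)
  have hz₀' : z₀ ∈ ball z₀ (ε / 2) := mem_ball_self (half_pos hε)
  have hcont' : Continuous fun θ : ℝ => deriv (circleMap c R) θ •
      (-a (circleMap c R θ) / (z₀ - γ (circleMap c R θ)) ^ 2) :=
    hdc.smul (hac.neg.div ((continuous_const.sub hγc).pow 2)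
      fun θ => pow_ne_zero 2 (hne θ z₀ hz₀'))
  have key := intervalIntegral.hasDerivAt_integral_of_dominated_loc_of_deriv_le
    (μ := MeasureTheory.volume) (a := 0) (b := 2 * Real.pi)
    (F := fun z θ => deriv (circleMap c R) θ •
      (a (circleMap c R θ) / (z - γ (circleMap c R θ))))
    (F' := fun z θ => deriv (circleMap c R) θ •
      (-a (circleMap c R θ) / (z - γ (circleMap c R θ)) ^ 2))
    (bound := fun θ => ‖deriv (circleMap c R) θ‖ * (‖a (circleMap c R θ)‖ / (ε / 2) ^ 2))
    (ball_mem_nhds z₀ (half_pos hε))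
    (eventually_of_mem (ball_mem_nhds z₀ (half_pos hε)) fun z hz =>
      (hcont z hz).aestronglyMeasurable)
    ((hcont z₀ hz₀').intervalIntegrable _ _)
    hcont'.aestronglyMeasurable
    (Eventually.of_forall fun θ _ z hz => by
      rw [norm_smul, norm_div, norm_neg, norm_pow]
      have := hfar θ z hz
      gcongr)
    ((hdc.norm.mul (hac.norm.div_const _)).intervalIntegrable _ _)
    (Eventually.of_forall fun θ _ z hz => by
      have h1 : HasDerivAt (fun z : ℂ => z - γ (circleMap c R θ)) 1 z :=
        (hasDerivAt_id z).sub_const _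
      have h2 := (h1.fun_inv (hne θ z hz)).const_mul (a (circleMap c R θ))
      have h3 := h2.const_smul (deriv (circleMap c R) θ)
      refine (h3.congr_deriv ?_).congr_of_eventuallyEq (Eventually.of_forall fun z => ?_)
      · simp only [smul_eq_mul]; ring
      · simp only [smul_eq_mul, div_eq_mul_inv, Pi.smul_apply])
  exact key.2.differentiableAt.differentiableWithinAt

theorem isOpen_annulus (a b : ℝ) : IsOpen {w : ℂ | a < ‖w‖ ∧ ‖w‖ < b} :=
  (isOpen_lt continuous_const continuous_norm).inter (isOpen_lt continuous_norm continuous_const)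

theorem circleIntegral_eq_of_differentiableOn_annulus {a b r R : ℝ} {F : ℂ → ℂ}
    (hF : DifferentiableOn ℂ F {w | a < ‖w‖ ∧ ‖w‖ < b}) (hr : 0 < r) (har : a < r)
    (hrR : r ≤ R) (hRb : R < b) :
    (∮ w in C(0, R), F w) = ∮ w in C(0, r), F w := by
  have hsub : closedBall (0 : ℂ) R \ ball 0 r ⊆ {w | a < ‖w‖ ∧ ‖w‖ < b} := by
    rintro w ⟨h1, h2⟩
    simp only [mem_closedBall, mem_ball, dist_zero_right, not_lt] at h1 h2
    exact ⟨har.trans_le h2, h1.trans_lt hRb⟩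
  refine circleIntegral_eq_of_differentiable_on_annulus_off_countable hr hrR
    Set.countable_empty (hF.continuousOn.mono hsub) fun w hw => ?_
  have hw' := hsub ⟨ball_subset_closedBall hw.1.1, fun h => hw.1.2 (ball_subset_closedBall h)⟩
  exact hF.differentiableAt ((isOpen_annulus a b).mem_nhds hw')

theorem circleIntegral_sub_inv_of_lt_norm {r : ℝ} (hr : 0 ≤ r) {w₀ : ℂ} (h : r < ‖w₀‖) :
    (∮ w in C(0, r), (w - w₀)⁻¹) = 0 := by
  have hne : ∀ w ∈ closedBall (0 : ℂ) r, w - w₀ ≠ 0 := by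
    intro w hw h0
    rw [sub_eq_zero] at h0
    subst h0
    simp only [mem_closedBall, dist_zero_right] at hw
    linarith
  refine circleIntegral_eq_zero_of_differentiable_on_off_countable hr Set.countable_empty
    ?_ fun w hw => ?_
  · exact ContinuousOn.inv₀ (by fun_prop) hne
  · exact DifferentiableAt.fun_inv (by fun_prop) (hne w (ball_subset_closedBall hw.1))

/-- The divided difference of H at w₀ is holomorphic on the whole annulus, so its integrals over the
two circles cancel. What remains is H(w₀) times the difference of the integrals of 1/(w - w₀), which
are 2πi and 0. -/
theorem circleIntegral_div_sub_of_differentiableOn_annulus {a b r R : ℝ} {H : ℂ → ℂ}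
    (hH : DifferentiableOn ℂ H {w | a < ‖w‖ ∧ ‖w‖ < b}) (hr : 0 < r) (har : a < r)
    (hRb : R < b) {w₀ : ℂ} (hw₀r : r < ‖w₀‖) (hw₀R : ‖w₀‖ < R) :
    (∮ w in C(0, R), H w / (w - w₀)) - (∮ w in C(0, r), H w / (w - w₀))
      = 2 * Real.pi * I * H w₀ := by
  have hopen := isOpen_annulus a b
  have hmem : {w : ℂ | a < ‖w‖ ∧ ‖w‖ < b} ∈ 𝓝 w₀ :=
    hopen.mem_nhds ⟨har.trans hw₀r, hw₀R.trans hRb⟩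
  have hd : DifferentiableOn ℂ (dslope H w₀) {w | a < ‖w‖ ∧ ‖w‖ < b} :=
    (Complex.differentiableOn_dslope hmem).2 hH
  have heq := circleIntegral_eq_of_differentiableOn_annulus hd hr har (hw₀r.trans hw₀R).le hRb
  have hsphere : ∀ s : ℝ, 0 < s → a < s → s < b → s ≠ ‖w₀‖ →
      (∮ w in C(0, s), H w / (w - w₀))
        = (∮ w in C(0, s), dslope H w₀ w) + H w₀ * ∮ w in C(0, s), (w - w₀)⁻¹ := by
    intro s hs has hsb hne
    have hsub : sphere (0 : ℂ) s ⊆ {w | a < ‖w‖ ∧ ‖w‖ < b} := by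
      intro w hw
      simp only [mem_sphere, dist_zero_right] at hw
      exact ⟨hw ▸ has, hw ▸ hsb⟩
    have hne' : ∀ w ∈ sphere (0 : ℂ) s, w - w₀ ≠ 0 := by
      intro w hw h0
      rw [sub_eq_zero] at h0
      subst h0
      simp only [mem_sphere, dist_zero_right] at hw
      exact hne hw.symm
    rw [← circleIntegral.integral_const_mul, ← circleIntegral.integral_add]
    · refine circleIntegral.integral_congr hs.le fun w hw => ?_
      have := hne' w hw
      rw [dslope_of_ne _ (sub_ne_zero.1 this), slope_def_field]
      field_simp
      ring
    · exact (hd.continuousOn.mono hsub).circleIntegrable hs.le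
    · refine ContinuousOn.circleIntegrable hs.le (continuousOn_const.mul ?_)
      exact ContinuousOn.inv₀ (by fun_prop) hne'
  rw [hsphere R (hr.trans (hw₀r.trans hw₀R)) (har.trans (hw₀r.trans hw₀R)) hRb hw₀R.ne',
    hsphere r hr har ((hw₀r.trans hw₀R).trans hRb) hw₀r.ne, heq,
    circleIntegral_sub_inv_of_lt_norm hr.le hw₀r,
    circleIntegral.integral_sub_inv_of_mem_ball (by simpa using hw₀R)]
  ring

/-- The map w ↦ t/w reverses the orientation of circles (the angle θ becomes arg t - θ). This
absorbs the sign of d(t/w) = -(t/w²) dw. -/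
theorem circleIntegral_comp_const_div {t : ℂ} (ht : t ≠ 0) {r : ℝ} (hr : 0 < r) (g : ℂ → ℂ) :
    (∮ w in C(0, r), t / w ^ 2 * g (t / w)) = ∮ w in C(0, ‖t‖ / r), g w := by
  have hperiodic : Function.Periodic (fun θ : ℝ =>
      deriv (circleMap 0 (‖t‖ / r)) θ • g (circleMap 0 (‖t‖ / r) θ)) (2 * Real.pi) := by
    intro θ
    simp only [deriv_circleMap, periodic_circleMap 0 (‖t‖ / r) θ]
  have hpt : ∀ θ : ℝ, t / circleMap 0 r θ = circleMap 0 (‖t‖ / r) (arg t - θ) := by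
    intro θ
    have h : t = ‖t‖ * exp (arg t * I) := (norm_mul_exp_arg_mul_I t).symm
    have hr' : (r : ℂ) ≠ 0 := by exact_mod_cast hr.ne'
    simp only [circleMap, zero_add]
    push_cast
    rw [sub_mul, Complex.exp_sub]
    nth_rewrite 1 [h]
    field_simp
  have hfun : ∀ θ : ℝ, deriv (circleMap 0 r) θ •
      (t / (circleMap 0 r θ) ^ 2 * g (t / circleMap 0 r θ))
      = deriv (circleMap 0 (‖t‖ / r)) (arg t - θ) • g (circleMap 0 (‖t‖ / r) (arg t - θ)) := by
    intro θ
    have hne : circleMap 0 r θ ≠ 0 := by simp [hr.ne']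
    simp only [deriv_circleMap, ← hpt, smul_eq_mul]
    field_simp
  simp only [circleIntegral, hfun]
  rw [intervalIntegral.integral_comp_sub_left (fun θ =>
      deriv (circleMap 0 (‖t‖ / r)) θ • g (circleMap 0 (‖t‖ / r) θ))]
  have := hperiodic.intervalIntegral_add_eq (arg t - 2 * Real.pi) 0
  simpa using this

/-- A function on `ℂ` minus finitely many closed sets whose singular part near each of these sets
is known is the sum of its singular parts. -/
theorem eqOn_sum_of_singular_parts {ι : Type*} (s : Finset ι) (B U : ι → Set ℂ)
    (hB : ∀ i ∈ s, IsClosed (B i)) (hU : ∀ i ∈ s, IsOpen (U i)) (hBU : ∀ i ∈ s, B i ⊆ U i)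
    (hdisj : ∀ i ∈ s, ∀ j ∈ s, i ≠ j → Disjoint (U i) (U j))
    {f : ℂ → ℂ} (hf : ∀ z, (∀ i ∈ s, z ∉ B i) → DifferentiableAt ℂ f z)
    (hf0 : Tendsto f (cocompact ℂ) (𝓝 0))
    {P g : ι → ℂ → ℂ} (hP : ∀ i ∈ s, DifferentiableOn ℂ (P i) (B i)ᶜ)
    (hP0 : ∀ i ∈ s, Tendsto (P i) (cocompact ℂ) (𝓝 0))
    (hg : ∀ i ∈ s, DifferentiableOn ℂ (g i) (U i))
    (hfg : ∀ i ∈ s, ∀ z ∈ U i, z ∉ B i → f z - P i z = g i z)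
    (hBc : ∀ i ∈ s, IsCompact (B i))
    {z : ℂ} (hz : ∀ i ∈ s, z ∉ B i) : f z = ∑ i ∈ s, P i z := by
  classical
  -- The difference of the two sides, continued into each `B i`. It is entire and tends to 0 at
  -- infinity, hence vanishes. The choice of index is harmless since the `U i` are disjoint.
  let G : ℂ → ℂ := fun z =>
    if h : ∃ i ∈ s, z ∈ B i then g h.choose z - ∑ j ∈ s.erase h.choose, P j z
    else f z - ∑ i ∈ s, P i z
  have hGout : ∀ z, (∀ i ∈ s, z ∉ B i) → G z = f z - ∑ i ∈ s, P i z := by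
    intro z hz
    exact dif_neg (by push Not; exact hz)
  have hGin : ∀ i ∈ s, ∀ z ∈ U i, G z = g i z - ∑ j ∈ s.erase i, P j z := by
    intro i hi z hzU
    by_cases hzB : z ∈ B i
    · have h : ∃ i ∈ s, z ∈ B i := ⟨i, hi, hzB⟩
      have hch : h.choose = i := by
        by_contra hne
        exact Set.disjoint_left.1 (hdisj _ h.choose_spec.1 i hi hne)
          (hBU _ h.choose_spec.1 h.choose_spec.2) hzU
      change dite _ _ _ = _
      rw [dif_pos h, hch]
    · rw [hGout z, ← hfg i hi z hzU hzB, ← Finset.add_sum_erase s (fun i => P i z) hi]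
      · ring
      · intro j hj hzj
        by_cases hij : j = i
        · exact hzB (hij ▸ hzj)
        · exact Set.disjoint_left.1 (hdisj j hj i hi hij) (hBU j hj hzj) hzU
  have hPdiff : ∀ i ∈ s, ∀ z, z ∉ B i → DifferentiableAt ℂ (P i) z := fun i hi z hz =>
    (hP i hi).differentiableAt ((hB i hi).isOpen_compl.mem_nhds hz)
  have hopen : IsOpen {z | ∀ i ∈ s, z ∉ B i} := by
    have : {z | ∀ i ∈ s, z ∉ B i} = (⋃ i ∈ s, B i)ᶜ := by ext; simp
    rw [this]
    exact (s.finite_toSet.isClosed_biUnion fun i hi => hB i hi).isOpen_compl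
  have hGd : Differentiable ℂ G := by
    intro z
    by_cases h : ∃ i ∈ s, z ∈ B i
    · obtain ⟨i, hi, hzB⟩ := h
      have hzU := hBU i hi hzB
      have hev : G =ᶠ[𝓝 z] fun z => g i z - ∑ j ∈ s.erase i, P j z :=
        eventually_of_mem ((hU i hi).mem_nhds hzU) (hGin i hi)
      refine DifferentiableAt.congr_of_eventuallyEq ?_ hev
      refine ((hg i hi).differentiableAt ((hU i hi).mem_nhds hzU)).sub ?_
      refine DifferentiableAt.fun_sum fun j hj => ?_
      obtain ⟨hji, hjs⟩ := Finset.mem_erase.1 hj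
      exact hPdiff j hjs z fun hzj =>
        Set.disjoint_left.1 (hdisj j hjs i hi hji) (hBU j hjs hzj) hzU
    · push Not at h
      have hev : G =ᶠ[𝓝 z] fun z => f z - ∑ i ∈ s, P i z :=
        eventually_of_mem (hopen.mem_nhds h) hGout
      exact DifferentiableAt.congr_of_eventuallyEq
        ((hf z h).sub (DifferentiableAt.fun_sum fun i hi => hPdiff i hi z (h i hi))) hev
  have hG0 : Tendsto G (cocompact ℂ) (𝓝 0) := by
    have hcpt : IsCompact (⋃ i ∈ s, B i) := s.isCompact_biUnion hBc
    have hlim : Tendsto (fun z => f z - ∑ i ∈ s, P i z) (cocompact ℂ) (𝓝 0) := by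
      simpa using hf0.sub (tendsto_finsetSum s fun i hi => hP0 i hi)
    refine hlim.congr' ?_
    filter_upwards [hcpt.compl_mem_cocompact] with z hz
    exact (hGout z (by simpa using hz)).symm
  have := hGd.apply_eq_of_tendsto_cocompact z hG0
  rw [hGout z hz] at this
  exact sub_eq_zero.1 this

end ComplexAnalysis

/-! ### Half-edges and the geometry of the coordinate disks. -/

namespace OpeningNodes

open Metric Complex

/-- The other end of the edge of a half-edge. -/
def opp {E : Type*} (h : E × Bool) : E × Bool := (h.1, !h.2)

theorem opp_opp {E : Type*} (h : E × Bool) : opp (opp h) = h := by simp [opp]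

/-- The sign of a half-edge. -/
def sign {E : Type*} (h : E × Bool) : ℂ := bif h.2 then 1 else -1

theorem sign_opp {E : Type*} (h : E × Bool) : sign (opp h) = -sign h := by
  rcases h with ⟨e, _ | _⟩ <;> simp [sign, opp]

theorem norm_sign {E : Type*} (h : E × Bool) : ‖sign h‖ = 1 := by
  rcases h with ⟨e, _ | _⟩ <;> simp [sign]

/-- The factor 2 accounts for loops, both ends of which lie at the same vertex. -/
theorem OrientedMultigraph.DegreeLE.finite {V E : Type*} {Γ : OrientedMultigraph V E} {k : ℕ}
    (hΓ : Γ.DegreeLE k) (v : V) :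
    {h : E × Bool | Γ.vert h = v}.Finite ∧ {h : E × Bool | Γ.vert h = v}.ncard ≤ 2 * k := by
  set S := {e : E | Γ.src e = v ∨ Γ.tgt e = v}
  have hS : S.Finite := Set.finite_of_encard_le_coe (hΓ v)
  have hSk : S.ncard ≤ k := by
    have := hΓ v
    rw [← hS.cast_ncard_eq] at this
    exact_mod_cast this
  have hsub : {h : E × Bool | Γ.vert h = v} ⊆ S ×ˢ (Set.univ : Set Bool) := by
    rintro ⟨e, _ | _⟩ h
    · exact ⟨Or.inl h, trivial⟩
    · exact ⟨Or.inr h, trivial⟩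
  have hfin : (S ×ˢ (Set.univ : Set Bool)).Finite := hS.prod Set.finite_univ
  refine ⟨hfin.subset hsub, (Set.ncard_le_ncard hsub hfin).trans ?_⟩
  rw [Set.ncard_prod, Set.ncard_univ, Nat.card_eq_fintype_card, Fintype.card_bool]
  omega

/-- The finite set of the half-edges at a vertex. -/
noncomputable def OrientedMultigraph.DegreeLE.halfEdges {V E : Type*}
    {Γ : OrientedMultigraph V E} {k : ℕ} (hΓ : Γ.DegreeLE k)
    (v : V) : Finset (E × Bool) := (hΓ.finite v).1.toFinset

theorem OrientedMultigraph.DegreeLE.mem_halfEdges {V E : Type*}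
    {Γ : OrientedMultigraph V E} {k : ℕ} (hΓ : Γ.DegreeLE k)
    (v : V) (h : E × Bool) : h ∈ hΓ.halfEdges v ↔ Γ.vert h = v := by
  simp [OrientedMultigraph.DegreeLE.halfEdges]

theorem OrientedMultigraph.DegreeLE.card_halfEdges_le {V E : Type*}
    {Γ : OrientedMultigraph V E} {k : ℕ} (hΓ : Γ.DegreeLE k)
    (v : V) : ((hΓ.halfEdges v).card : ℝ) ≤ 2 * k := by
  have := (hΓ.finite v).2
  rw [Set.ncard_eq_toFinset_card _ (hΓ.finite v).1] at this
  exact_mod_cast this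

namespace AdmissibleCoordinates

variable {V E : Type*} {Γ : OrientedMultigraph V E} {ρ c₁ c₂ : ℝ}
  (A : AdmissibleCoordinates Γ ρ c₁ c₂)

theorem mem_target {h : E × Bool} {w : ℂ} : w ∈ (A.coord h).target ↔ ‖w‖ < ρ := by
  rw [A.coord_target, mem_ball, dist_zero_right]

theorem norm_coord_lt {h : E × Bool} {z : ℂ} (hz : z ∈ (A.coord h).source) :
    ‖A.coord h z‖ < ρ :=
  A.mem_target.1 ((A.coord h).map_source hz)

theorem symm_mem {h : E × Bool} {w : ℂ} (hw : ‖w‖ < ρ) :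
    (A.coord h).symm w ∈ (A.coord h).source :=
  (A.coord h).map_target (A.mem_target.2 hw)

theorem coord_symm {h : E × Bool} {w : ℂ} (hw : ‖w‖ < ρ) :
    A.coord h ((A.coord h).symm w) = w :=
  (A.coord h).right_inv (A.mem_target.2 hw)

theorem symm_zero (h : E × Bool) : (A.coord h).symm 0 = A.p h := by
  rw [← A.coord_p h, (A.coord h).left_inv (A.p_mem h)]

theorem symm_lower {h : E × Bool} {w : ℂ} (hw : ‖w‖ < ρ) :
    c₁ * ‖w‖ ≤ ‖(A.coord h).symm w - A.p h‖ := by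
  simpa [A.coord_symm hw] using A.lower h _ (A.symm_mem hw)

theorem symm_upper {h : E × Bool} {w : ℂ} (hw : ‖w‖ < ρ) :
    ‖(A.coord h).symm w - A.p h‖ ≤ c₂ * ‖w‖ := by
  simpa [A.coord_symm hw] using A.upper h _ (A.symm_mem hw)

theorem symm_differentiableOn (h : E × Bool) :
    DifferentiableOn ℂ (A.coord h).symm (ball 0 ρ) :=
  A.coord_target h ▸ A.coord_symm_holo h

theorem symm_differentiableAt {h : E × Bool} {w : ℂ} (hw : ‖w‖ < ρ) :
    DifferentiableAt ℂ (A.coord h).symm w :=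
  (A.symm_differentiableOn h).differentiableAt (isOpen_ball.mem_nhds (by simpa using hw))

theorem coord_differentiableAt {h : E × Bool} {z : ℂ} (hz : z ∈ (A.coord h).source) :
    DifferentiableAt ℂ (A.coord h) z :=
  (A.coord_holo h).differentiableAt ((A.coord h).open_source.mem_nhds hz)

theorem deriv_coord_mul_deriv_symm {h : E × Bool} {w : ℂ} (hw : ‖w‖ < ρ) :
    deriv (A.coord h) ((A.coord h).symm w) * deriv (A.coord h).symm w = 1 := by
  have h1 := (A.coord_differentiableAt (A.symm_mem (h := h) hw)).hasDerivAt.comp w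
    (A.symm_differentiableAt hw).hasDerivAt
  have h2 : (A.coord h) ∘ (A.coord h).symm =ᶠ[𝓝 w] id :=
    eventually_of_mem (isOpen_ball.mem_nhds (show w ∈ ball (0 : ℂ) ρ by simpa using hw))
      fun w' hw' => A.coord_symm (by simpa using hw')
  exact (h1.congr_of_eventuallyEq h2.symm).unique (hasDerivAt_id w)

theorem deriv_symm_ne_zero {h : E × Bool} {w : ℂ} (hw : ‖w‖ < ρ) :
    deriv (A.coord h).symm w ≠ 0 :=
  right_ne_zero_of_mul_eq_one (A.deriv_coord_mul_deriv_symm hw)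

theorem symm_injOn (h : E × Bool) : Set.InjOn (A.coord h).symm (ball 0 ρ) :=
  A.coord_target h ▸ (A.coord h).symm.injOn

/-- Cauchy's estimate on a circle of radius ρ/4, where |ψ - p| ≤ 3c₂ρ/4. The constant 3 is below 2π,
so it disappears in `norm_pull_le`. -/
theorem norm_deriv_symm_le (hρ : 0 < ρ) (hc₂ : 0 < c₂) {h : E × Bool} {w : ℂ}
    (hw : ‖w‖ ≤ ρ / 2) : ‖deriv (A.coord h).symm w‖ ≤ 3 * c₂ := by
  have hsub : ∀ z ∈ closedBall w (ρ / 4), ‖z‖ ≤ 3 * ρ / 4 := by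
    intro z hz
    have h1 : ‖z - w‖ ≤ ρ / 4 := by simpa [dist_eq_norm] using hz
    have h2 := norm_le_norm_add_norm_sub' z w
    linarith
  have hd : DifferentiableOn ℂ (fun z => (A.coord h).symm z - A.p h) (closedBall w (ρ / 4)) :=
    fun z hz => ((A.symm_differentiableAt (by have := hsub z hz; linarith)).sub_const _)
      |>.differentiableWithinAt
  have := Complex.norm_deriv_le_of_forall_mem_sphere_norm_le (R := ρ / 4) (C := 3 * c₂ * ρ / 4)
    (by positivity) (hd.diffContOnCl_ball subset_rfl) fun z hz => by
      have h1 := hsub z (sphere_subset_closedBall hz)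
      refine (A.symm_upper (by linarith)).trans ?_
      nlinarith
  rw [deriv_sub_const_fun] at this
  refine this.trans (le_of_eq ?_)
  field_simp

theorem isCompact_symm_image (h : E × Bool) {s : ℝ} (hs : s < ρ) :
    IsCompact ((A.coord h).symm '' closedBall 0 s) :=
  (isCompact_closedBall 0 s).image_of_continuousOn <|
    (A.symm_differentiableOn h).continuousOn.mono (closedBall_subset_ball hs)

theorem mem_symm_image {h : E × Bool} {s : ℝ} (hs : s < ρ) {z : ℂ} :
    z ∈ (A.coord h).symm '' closedBall 0 s ↔ z ∈ (A.coord h).source ∧ ‖A.coord h z‖ ≤ s := by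
  constructor
  · rintro ⟨w, hw, rfl⟩
    have hw' : ‖w‖ ≤ s := by simpa using hw
    exact ⟨A.symm_mem (hw'.trans_lt hs), by rwa [A.coord_symm (hw'.trans_lt hs)]⟩
  · rintro ⟨h1, h2⟩
    exact ⟨A.coord h z, by simpa using h2, (A.coord h).left_inv h1⟩

/-- By connectedness of the ball: the lower distance bound keeps |z_h| ≤ s < ρ near a limit point in
the ball, and the points with |z_h| ≤ s form a compact set, so the limit stays in the disk. -/
theorem ball_subset_source (hc₁ : 0 < c₁) (h : E × Bool) :
    ball (A.p h) (c₁ * ρ) ⊆ (A.coord h).source := by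
  by_cases hρ : 0 < ρ
  swap
  · rw [ball_eq_empty.2 (mul_nonpos_of_nonneg_of_nonpos hc₁.le (not_lt.1 hρ))]
    exact Set.empty_subset _
  refine (convex_ball (A.p h) (c₁ * ρ)).isPreconnected.subset_of_closure_inter_subset
    (A.coord h).open_source ⟨A.p h, mem_ball_self (by positivity), A.p_mem h⟩ ?_
  rintro x ⟨hx, hxb⟩
  have hx1 : ‖x - A.p h‖ / c₁ < ρ := by
    rw [div_lt_iff₀ hc₁, mul_comm]
    simpa [dist_eq_norm] using hxb
  obtain ⟨s, hs1, hs2⟩ := exists_between hx1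
  have hxs : x ∈ ball (A.p h) (c₁ * s) := by
    rw [div_lt_iff₀ hc₁, mul_comm] at hs1
    simpa [dist_eq_norm] using hs1
  have hmem : x ∈ closure ((A.coord h).symm '' closedBall 0 s) := by
    have h1 := (isOpen_ball.inter_closure (t := (A.coord h).source)) ⟨hxs, hx⟩
    refine closure_mono ?_ h1
    rintro z ⟨hzb, hz⟩
    refine (A.mem_symm_image hs2).2 ⟨hz, ?_⟩
    have h2 : ‖z - A.p h‖ < c₁ * s := by simpa [dist_eq_norm] using hzb
    exact (lt_of_mul_lt_mul_left ((A.lower h z hz).trans_lt h2) hc₁.le).le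
  rw [(A.isCompact_symm_image h hs2).isClosed.closure_eq] at hmem
  exact ((A.mem_symm_image hs2).1 hmem).1

theorem le_norm_sub_of_notMem (hc₁ : 0 < c₁) {h : E × Bool} {z : ℂ}
    (hz : z ∉ (A.coord h).source) : c₁ * ρ ≤ ‖z - A.p h‖ := by
  by_contra! hlt
  exact hz (A.ball_subset_source hc₁ h (by simpa [dist_eq_norm] using hlt))

theorem notMem_source {h h' : E × Bool} (hne : h ≠ h') (hv : Γ.vert h = Γ.vert h') {z : ℂ}
    (hz : z ∈ (A.coord h).source) : z ∉ (A.coord h').source :=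
  Set.disjoint_left.1 (A.disjoint h h' hne hv) hz

theorem isClosed_removed {t : E → ℂ} (hρ : 0 < ρ) {h : E × Bool} (ht : ‖t h.1‖ < ρ ^ 2) :
    IsClosed (A.removed t h) := by
  have hs : ‖t h.1‖ / ρ < ρ := by rw [div_lt_iff₀ hρ]; nlinarith
  have : A.removed t h = (A.coord h).symm '' closedBall 0 (‖t h.1‖ / ρ) := by
    ext z
    rw [A.mem_symm_image hs]
    rfl
  rw [this]
  exact (A.isCompact_symm_image h hs).isClosed

theorem isOpen_smoothPart {t : E → ℂ} (hρ : 0 < ρ) (ht : ∀ e, ‖t e‖ < ρ ^ 2) {v : V}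
    (hv : {h | Γ.vert h = v}.Finite) : IsOpen (A.smoothPart t v) := by
  have : A.smoothPart t v = (⋃ h ∈ {h | Γ.vert h = v}, A.removed t h)ᶜ := by
    ext z
    simp [smoothPart]
  rw [this]
  exact (hv.isClosed_biUnion fun h _ => A.isClosed_removed hρ (ht h.1)).isOpen_compl

theorem mem_smoothPart_of_mem_source {t : E → ℂ} {h : E × Bool} {z : ℂ}
    (hz : z ∈ (A.coord h).source) :
    z ∈ A.smoothPart t (Γ.vert h) ↔ ‖t h.1‖ / ρ < ‖A.coord h z‖ := by
  constructor
  · intro hs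
    by_contra! hle
    exact hs h rfl ⟨hz, hle⟩
  · rintro hlt h' hv ⟨hz', hle⟩
    by_cases hne : h = h'
    · subst hne
      exact absurd hlt hle.not_gt
    · exact A.notMem_source hne hv.symm hz hz'

theorem symm_mem_smoothPart {t : E → ℂ} {h : E × Bool} {w : ℂ} (hw : ‖w‖ < ρ)
    (htw : ‖t h.1‖ / ρ < ‖w‖) : (A.coord h).symm w ∈ A.smoothPart t (Γ.vert h) := by
  rw [A.mem_smoothPart_of_mem_source (A.symm_mem hw), A.coord_symm hw]
  exact htw

end AdmissibleCoordinates

end OpeningNodes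

/-! ### Decay at infinity; the differential in neck coordinates, its periods and singular parts. -/

section ComplexAnalysis

open Metric Complex

theorem tendsto_circleIntegral_div_sub_cocompact {a γ : ℂ → ℂ} {c : ℂ} {R : ℝ} (hR : 0 ≤ R)
    (ha : ContinuousOn a (sphere c R)) (hγ : ContinuousOn γ (sphere c R)) :
    Tendsto (fun z => ∮ w in C(c, R), a w / (z - γ w)) (cocompact ℂ) (𝓝 0) := by
  obtain ⟨M, hM⟩ := (isCompact_sphere c R).exists_bound_of_continuousOn ha
  obtain ⟨K, hK⟩ := (isCompact_sphere c R).exists_bound_of_continuousOn hγ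
  have hlim : Tendsto (fun z : ℂ => 2 * Real.pi * R * (|M| / (‖z‖ - K))) (cocompact ℂ) (𝓝 0) := by
    have h1 : Tendsto (fun z : ℂ => ‖z‖ - K) (cocompact ℂ) atTop :=
      tendsto_atTop_add_const_right _ _ (tendsto_norm_cocompact_atTop)
    simpa using (h1.const_div_atTop |M|).const_mul (2 * Real.pi * R)
  refine squeeze_zero_norm' ?_ hlim
  filter_upwards [(tendsto_norm_cocompact_atTop (E := ℂ)).eventually_gt_atTop K] with z hz
  refine circleIntegral.norm_integral_le_of_norm_le_const hR fun w hw => ?_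
  rw [norm_div]
  have h1 := hK w hw
  have h2 : ‖z‖ - ‖γ w‖ ≤ ‖z - γ w‖ := norm_sub_norm_le _ _
  exact div_le_div₀ (abs_nonneg M) ((hM w hw).trans (le_abs_self M)) (by linarith) (by linarith)

end ComplexAnalysis

namespace OpeningNodes

open Metric Complex

namespace AdmissibleCoordinates

namespace RegularDifferential

variable {V E : Type*} {Γ : OrientedMultigraph V E} {ρ c₁ c₂ : ℝ}
  {A : AdmissibleCoordinates Γ ρ c₁ c₂} {t : E → ℂ} (ω : A.RegularDifferential t)

/-- The coefficient of `ω` in the coordinate `w` of the disk of a half-edge. -/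
noncomputable def pull (h : E × Bool) (w : ℂ) : ℂ :=
  ω.f (Γ.vert h) ((A.coord h).symm w) * deriv (A.coord h).symm w

theorem differentiableAt {k : ℕ} (hΓ : Γ.DegreeLE k) (hρ : 0 < ρ) (ht : ∀ e, ‖t e‖ < ρ ^ 2)
    {v : V} {z : ℂ} (hz : z ∈ A.smoothPart t v) : DifferentiableAt ℂ (ω.f v) z :=
  (ω.holo v).differentiableAt ((A.isOpen_smoothPart hρ ht (hΓ.finite v).1).mem_nhds hz)

theorem differentiableOn_pull (h : E × Bool) :
    DifferentiableOn ℂ (ω.pull h) {w | ‖t h.1‖ / ρ < ‖w‖ ∧ ‖w‖ < ρ} := by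
  refine DifferentiableOn.mul ?_ ?_
  · exact (ω.holo _).comp (fun w hw => (A.symm_differentiableAt hw.2).differentiableWithinAt)
      fun w hw => A.symm_mem_smoothPart hw.2 hw.1
  · exact ((A.symm_differentiableOn h).deriv isOpen_ball).mono fun w hw => by simpa using hw.2

theorem continuousOn_pull {h : E × Bool} {r : ℝ} (h1 : ‖t h.1‖ / ρ < r) (h2 : r < ρ) :
    ContinuousOn (ω.pull h) (sphere 0 r) := by
  refine (ω.differentiableOn_pull h).continuousOn.mono fun w hw => ?_
  simp only [mem_sphere, dist_zero_right] at hw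
  exact ⟨hw ▸ h1, hw ▸ h2⟩

theorem norm_const_div_bounds (hρ : 0 < ρ) {τ w : ℂ} (h1 : ‖τ‖ / ρ < ‖w‖) (h2 : ‖w‖ < ρ)
    (hτ : τ ≠ 0) : ‖τ‖ / ρ < ‖τ / w‖ ∧ ‖τ / w‖ < ρ := by
  have hτ' := norm_pos_iff.2 hτ
  have hw : 0 < ‖w‖ := (div_pos hτ' hρ).trans h1
  rw [norm_div]
  refine ⟨div_lt_div_of_pos_left hτ' hw h2, ?_⟩
  rw [div_lt_iff₀ hρ] at h1
  rw [div_lt_iff₀ hw]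
  linarith

/-- In the coordinates of the two disks the gluing map is w ↦ t/w, so this is the gluing condition
after the chain rule. -/
theorem pull_false (hρ : 0 < ρ) {e : E} (hte : t e ≠ 0) {w : ℂ} (h1 : ‖t e‖ / ρ < ‖w‖)
    (h2 : ‖w‖ < ρ) : ω.pull (e, false) w = -(t e / w ^ 2) * ω.pull (e, true) (t e / w) := by
  have hw : w ≠ 0 := norm_pos_iff.1 ((div_nonneg (norm_nonneg _) hρ.le).trans_lt h1)
  have h3 := (norm_const_div_bounds hρ h1 h2 hte).2
  have hg := ω.glue e hte _ (A.symm_mem (h := (e, false)) h2) (by rwa [A.coord_symm h2])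
  have hd : HasDerivAt (A.transition t e) (deriv (A.coord (e, true)).symm (t e / w) *
      (-(t e / w ^ 2) * deriv (A.coord (e, false)) ((A.coord (e, false)).symm w)))
      ((A.coord (e, false)).symm w) := by
    have d1 : HasDerivAt (A.coord (e, true)).symm (deriv (A.coord (e, true)).symm (t e / w))
        (t e / w) := (A.symm_differentiableAt h3).hasDerivAt
    have d2 : HasDerivAt (fun u => t e / u) (-(t e / w ^ 2)) w := by
      have := (hasDerivAt_inv hw).const_mul (t e)
      simp only [← div_eq_mul_inv] at this
      exact this.congr_deriv (by ring)
    have d3 := (A.coord_differentiableAt (A.symm_mem (h := (e, false)) h2)).hasDerivAt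
    have d4 := d2.comp_of_eq _ d3 (A.coord_symm h2).symm
    exact d1.comp_of_eq _ d4 (by simp [A.coord_symm h2])
  rw [hd.deriv] at hg
  have hc := A.deriv_coord_mul_deriv_symm (h := (e, false)) h2
  have htr : A.transition t e ((A.coord (e, false)).symm w)
      = (A.coord (e, true)).symm (t e / w) := by
    simp [transition, A.coord_symm h2]
  rw [htr] at hg
  change ω.f (Γ.src e) _ * _ = _ * (ω.f (Γ.tgt e) _ * _)
  rw [← hg]
  linear_combination (ω.f (Γ.tgt e) ((A.coord (e, true)).symm (t e / w)) *
    deriv (A.coord (e, true)).symm (t e / w) * -(t e / w ^ 2)) * hc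

theorem pull_opp (hρ : 0 < ρ) {h : E × Bool} (hth : t h.1 ≠ 0) {w : ℂ}
    (h1 : ‖t h.1‖ / ρ < ‖w‖) (h2 : ‖w‖ < ρ) :
    ω.pull (opp h) w = -(t h.1 / w ^ 2) * ω.pull h (t h.1 / w) := by
  rcases h with ⟨e, _ | _⟩
  · have hw : w ≠ 0 := norm_pos_iff.1 ((div_nonneg (norm_nonneg _) hρ.le).trans_lt h1)
    simp only at hth h1 ⊢
    have h3 := norm_const_div_bounds hρ h1 h2 hth
    rw [ω.pull_false hρ hth h3.1 h3.2]
    have : t e / (t e / w) = w := by field_simp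
    rw [this]
    change ω.pull (e, true) w = _
    field_simp
  · exact ω.pull_false hρ hth h1 h2

theorem exists_residue {e : E} (hte : t e = 0) :
    ∃ c : ℂ, ∀ s : Bool, Tendsto (fun z => (z - A.p (e, s)) * ω.f (Γ.vert (e, s)) z)
      (𝓝[≠] A.p (e, s)) (𝓝 (sign (e, s) * c)) := by
  obtain ⟨c, hc1, hc2⟩ := ω.node e hte
  refine ⟨c, ?_⟩
  rintro (_ | _)
  · rw [show sign (e, false) * c = -c by simp [sign]]
    exact hc2
  · rw [show sign (e, true) * c = c by simp [sign]]
    exact hc1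

/-- The residue does not depend on the coordinate: (ψ(w) - p)/w tends to ψ'(0) ≠ 0, which cancels
the factor ψ'(w). -/
theorem circleIntegral_pull_of_residue (hρ : 0 < ρ) {h : E × Bool} (hth : t h.1 = 0) {c : ℂ}
    (hc : Tendsto (fun z => (z - A.p h) * ω.f (Γ.vert h) z) (𝓝[≠] A.p h) (𝓝 c)) {r : ℝ}
    (hr : 0 < r) (hrρ : r < ρ) : (∮ w in C(0, r), ω.pull h w) = 2 * Real.pi * I * c := by
  have hd := ω.differentiableOn_pull h
  rw [hth, norm_zero, zero_div] at hd
  have h0 : ‖(0 : ℂ)‖ < ρ := by simpa using hρ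
  have hψd := (A.symm_differentiableAt (h := h) h0).hasDerivAt
  have hne : ∀ᶠ w in 𝓝[≠] (0 : ℂ), (A.coord h).symm w ≠ A.p h ∧ w ≠ 0 := by
    filter_upwards [self_mem_nhdsWithin, mem_nhdsWithin_of_mem_nhds (ball_mem_nhds (0 : ℂ) hρ)]
      with w hw hwb
    refine ⟨fun heq => hw ?_, hw⟩
    rw [← A.symm_zero] at heq
    exact A.symm_injOn h hwb (mem_ball_self hρ) heq
  have hψ : Tendsto (A.coord h).symm (𝓝[≠] 0) (𝓝[≠] A.p h) := by
    refine tendsto_nhdsWithin_iff.2 ⟨?_, hne.mono fun w hw => hw.1⟩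
    have := hψd.continuousAt.tendsto
    rw [A.symm_zero] at this
    exact this.mono_left nhdsWithin_le_nhds
  have hslope := hasDerivAt_iff_tendsto_slope.1 hψd
  have hderiv : Tendsto (deriv (A.coord h).symm) (𝓝[≠] 0) (𝓝 (deriv (A.coord h).symm 0)) :=
    ((((A.symm_differentiableOn h).deriv isOpen_ball).differentiableAt
      (ball_mem_nhds 0 hρ)).continuousAt.tendsto).mono_left nhdsWithin_le_nhds
  have hlim := ((hc.comp hψ).mul (hslope.inv₀ (A.deriv_symm_ne_zero h0))).mul hderiv
  rw [mul_assoc, inv_mul_cancel₀ (A.deriv_symm_ne_zero h0), mul_one] at hlim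
  have hlim' : Tendsto (fun w => w * ω.pull h w) (𝓝[≠] 0) (𝓝 c) := by
    refine hlim.congr' ?_
    filter_upwards [hne] with w hw
    have h1 := sub_ne_zero.2 hw.1
    have h2 := hw.2
    simp only [Function.comp_apply, slope_def_field, A.symm_zero, pull, sub_zero]
    field_simp
  have hsub : closedBall (0 : ℂ) r \ {0} ⊆ {w | 0 < ‖w‖ ∧ ‖w‖ < ρ} := by
    rintro w ⟨hw1, hw2⟩
    exact ⟨norm_pos_iff.2 hw2, (by simpa using hw1 : ‖w‖ ≤ r).trans_lt hrρ⟩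
  have hdm : DifferentiableOn ℂ (fun w => w * ω.pull h w) {w | 0 < ‖w‖ ∧ ‖w‖ < ρ} :=
    differentiableOn_id.mul hd
  have key := circleIntegral_sub_center_inv_smul_of_differentiable_on_off_countable_of_tendsto
    hr Set.countable_empty (hdm.continuousOn.mono hsub)
    (fun w hw => hdm.differentiableAt ((isOpen_annulus 0 ρ).mem_nhds
      (hsub ⟨ball_subset_closedBall hw.1.1, hw.1.2⟩))) hlim'
  rw [smul_eq_mul] at key
  rw [← key]
  refine circleIntegral.integral_congr hr.le fun w hw => ?_
  have hw0 : w ≠ 0 := by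
    rintro rfl
    simp only [mem_sphere, dist_self] at hw
    exact hr.ne hw
  simp [hw0]

theorem circleIntegral_pull_eq {h : E × Bool} (hρ : 0 < ρ) {r s : ℝ}
    (hr1 : ‖t h.1‖ / ρ < r) (hr2 : r < ρ) (hs1 : ‖t h.1‖ / ρ < s) (hs2 : s < ρ) :
    (∮ w in C(0, r), ω.pull h w) = ∮ w in C(0, s), ω.pull h w := by
  have hnn : 0 ≤ ‖t h.1‖ / ρ := by positivity
  rcases le_total r s with hrs | hrs
  · exact (circleIntegral_eq_of_differentiableOn_annulus (ω.differentiableOn_pull h)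
      (hnn.trans_lt hr1) hr1 hrs hs2).symm
  · exact circleIntegral_eq_of_differentiableOn_annulus (ω.differentiableOn_pull h)
      (hnn.trans_lt hs1) hs1 hrs hr2

/-- The boundary circles at the two ends of a neck are homologous up to orientation; at a node, the
residues are opposite. -/
theorem circleIntegral_pull_opp (hρ : 0 < ρ) {h : E × Bool} {r : ℝ}
    (hr1 : ‖t h.1‖ / ρ < r) (hr2 : r < ρ) :
    (∮ w in C(0, r), ω.pull (opp h) w) = -∮ w in C(0, r), ω.pull h w := by
  have hr : 0 < r := (div_nonneg (norm_nonneg _) hρ.le).trans_lt hr1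
  by_cases hth : t h.1 = 0
  · obtain ⟨c, hc⟩ := ω.exists_residue hth
    rw [ω.circleIntegral_pull_of_residue hρ hth (hc h.2) hr hr2,
      ω.circleIntegral_pull_of_residue (h := opp h) hρ hth (hc (!h.2)) hr hr2]
    have : sign (h.1, !h.2) = -sign h := sign_opp h
    rw [this]
    ring
  · have h3 : ‖t h.1‖ / r < ρ := by
      rw [div_lt_iff₀ hρ] at hr1
      rw [div_lt_iff₀ hr]
      linarith
    have h4 : ‖t h.1‖ / ρ < ‖t h.1‖ / r := div_lt_div_of_pos_left (norm_pos_iff.2 hth) hr hr2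
    rw [ω.circleIntegral_pull_eq hρ hr1 hr2 h4 h3, ← circleIntegral_comp_const_div hth hr,
      ← neg_one_mul, ← circleIntegral.integral_const_mul]
    refine circleIntegral.integral_congr hr.le fun w hw => ?_
    simp only [mem_sphere, dist_zero_right] at hw
    rw [ω.pull_opp hρ hth (hw ▸ hr1) (hw ▸ hr2)]
    ring

theorem circleIntegral_pull (hρ : 0 < ρ) (h : E × Bool) {r : ℝ} (hr1 : ‖t h.1‖ / ρ < r)
    (hr2 : r < ρ) : (∮ w in C(0, r), ω.pull h w) = sign h * ω.period h.1 := by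
  have htr : ∀ e, ‖t e‖ / ρ < r → (∮ w in C(0, r), ω.pull (e, true) w) = ω.period e := by
    intro e he
    exact ω.circleIntegral_pull_eq (h := (e, true)) hρ he hr2 (by simp only; linarith)
      (by linarith)
  rcases h with ⟨e, _ | _⟩
  · have := ω.circleIntegral_pull_opp (h := (e, true)) hρ hr1 hr2
    rw [htr e hr1] at this
    simpa [sign, opp] using this
  · simpa [sign] using htr e hr1

/-- The part of `2πi ω` which is singular in the disk of the half-edge `h`. -/
noncomputable def singularPart (r : ℝ) (h : E × Bool) (z : ℂ) : ℂ :=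
  -∮ w in C(0, r), ω.pull (opp h) w / (z - (A.coord h).symm (t h.1 / w))

theorem norm_div_lt {τ : ℂ} {r : ℝ} (hρ : 0 < ρ) (hr1 : ‖τ‖ / ρ < r) : ‖τ‖ / r < ρ := by
  have hr : 0 < r := (div_nonneg (norm_nonneg _) hρ.le).trans_lt hr1
  rw [div_lt_iff₀ hρ] at hr1
  rw [div_lt_iff₀ hr]
  linarith

theorem continuousOn_symm_div {h : E × Bool} (hρ : 0 < ρ) {r : ℝ} (hr1 : ‖t h.1‖ / ρ < r) :
    ContinuousOn (fun w => (A.coord h).symm (t h.1 / w)) (sphere 0 r) := by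
  have hr : 0 < r := (div_nonneg (norm_nonneg _) hρ.le).trans_lt hr1
  refine (A.symm_differentiableOn h).continuousOn.comp ?_ fun w hw => ?_
  · refine ContinuousOn.div continuousOn_const continuousOn_id fun w hw => ?_
    exact ne_of_mem_sphere hw hr.ne'
  · simp only [mem_sphere, dist_zero_right] at hw
    simpa [hw] using norm_div_lt hρ hr1

theorem differentiableOn_singularPart {h : E × Bool} (hρ : 0 < ρ) {r : ℝ}
    (hr1 : ‖t h.1‖ / ρ < r) (hr2 : r < ρ) :
    DifferentiableOn ℂ (ω.singularPart r h)
      ((A.coord h).symm '' closedBall 0 (‖t h.1‖ / r))ᶜ := by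
  have hr : 0 < r := (div_nonneg (norm_nonneg _) hρ.le).trans_lt hr1
  refine (differentiableOn_circleIntegral_div_sub hr.le (ω.continuousOn_pull (h := opp h) hr1 hr2)
    (continuousOn_symm_div hρ hr1)
    (A.isCompact_symm_image h (norm_div_lt hρ hr1)).isClosed.isOpen_compl fun w hw => ?_).neg
  simp only [mem_sphere, dist_zero_right] at hw
  simp only [Set.mem_compl_iff, not_not]
  exact ⟨_, by simp [hw], rfl⟩

theorem tendsto_singularPart {h : E × Bool} (hρ : 0 < ρ) {r : ℝ}
    (hr1 : ‖t h.1‖ / ρ < r) (hr2 : r < ρ) :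
    Tendsto (ω.singularPart r h) (cocompact ℂ) (𝓝 0) := by
  have hr : 0 < r := (div_nonneg (norm_nonneg _) hρ.le).trans_lt hr1
  rw [← neg_zero]
  exact (tendsto_circleIntegral_div_sub_cocompact hr.le
    (ω.continuousOn_pull (h := opp h) hr1 hr2) (continuousOn_symm_div hρ hr1)).neg

theorem tendsto_f (v : V) : Tendsto (ω.f v) (cocompact ℂ) (𝓝 0) := by
  obtain ⟨g, hg, hev⟩ := ω.holo_infty v
  have h1 : Tendsto (fun w => -(w ^ 2 * g w)) (𝓝[≠] 0) (𝓝 0) := by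
    have h2 : ContinuousAt (fun w : ℂ => -(w ^ 2 * g w)) 0 :=
      ((continuousAt_id.pow 2).mul hg.continuousAt).neg
    simpa [ContinuousAt] using h2.tendsto.mono_left nhdsWithin_le_nhds
  have h2 : Tendsto (fun w => ω.f v w⁻¹) (𝓝[≠] 0) (𝓝 0) := by
    refine h1.congr' ?_
    filter_upwards [hev, self_mem_nhdsWithin] with w hw hw0
    have hw0' : w ≠ 0 := hw0
    rw [← hw]
    field_simp
  rw [← Metric.cobounded_eq_cocompact]
  simpa [Function.comp_def] using h2.comp (Filter.tendsto_inv₀_cobounded' (α := ℂ))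

end RegularDifferential

end AdmissibleCoordinates

end OpeningNodes

/-! ### Decomposition of ω into singular parts. -/

namespace OpeningNodes

open Metric Complex

namespace AdmissibleCoordinates

namespace RegularDifferential

variable {V E : Type*} {Γ : OrientedMultigraph V E} {ρ c₁ c₂ : ℝ}
  {A : AdmissibleCoordinates Γ ρ c₁ c₂} {t : E → ℂ} (ω : A.RegularDifferential t)

theorem singularPart_of_eq_zero (hρ : 0 < ρ) {h : E × Bool} (hth : t h.1 = 0) {c : ℂ}
    (hc : Tendsto (fun z => (z - A.p (opp h)) * ω.f (Γ.vert (opp h)) z) (𝓝[≠] A.p (opp h)) (𝓝 c))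
    {r : ℝ} (hr : 0 < r) (hr2 : r < ρ) (z : ℂ) :
    ω.singularPart r h z = -(2 * Real.pi * I * c) / (z - A.p h) := by
  rw [← ω.circleIntegral_pull_of_residue (h := opp h) hρ hth hc hr hr2, singularPart,
    neg_div, div_eq_inv_mul, ← circleIntegral.integral_const_mul]
  simp only [hth, zero_div, A.symm_zero]
  simp only [div_eq_inv_mul]

/-- The substitution w ↦ t/w carries the integral back through the neck, which identifies it as the
inner Cauchy integral in the disk of h. -/
theorem singularPart_of_ne_zero (hρ : 0 < ρ) {h : E × Bool} (hth : t h.1 ≠ 0) {r : ℝ}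
    (hr1 : ‖t h.1‖ / ρ < r) (hr2 : r < ρ) (z : ℂ) :
    ω.singularPart r h z
      = ∮ w in C(0, ‖t h.1‖ / r), ω.pull h w / (z - (A.coord h).symm w) := by
  have hr : 0 < r := (div_nonneg (norm_nonneg _) hρ.le).trans_lt hr1
  rw [← circleIntegral_comp_const_div hth hr, singularPart, ← neg_one_mul,
    ← circleIntegral.integral_const_mul]
  refine circleIntegral.integral_congr hr.le fun w hw => ?_
  simp only [mem_sphere, dist_zero_right] at hw
  rw [ω.pull_opp hρ hth (hw ▸ hr1) (hw ▸ hr2)]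
  ring

theorem exists_extension_of_eq_zero (hρ : 0 < ρ) {h : E × Bool}
    (hth : t h.1 = 0) {r : ℝ} (hr : 0 < r) (hr2 : r < ρ) :
    ∃ g : ℂ → ℂ, DifferentiableOn ℂ g (A.coord h).source ∧
      ∀ z ∈ (A.coord h).source, z ∉ (A.coord h).symm '' closedBall 0 (‖t h.1‖ / r) →
        2 * Real.pi * I * ω.f (Γ.vert h) z - ω.singularPart r h z = g z := by
  obtain ⟨c, hc⟩ := ω.exists_residue hth
  have hsm : (A.coord h).source \ {A.p h} ⊆ A.smoothPart t (Γ.vert h) := by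
    rintro z ⟨hz, hzp⟩
    rw [A.mem_smoothPart_of_mem_source hz, hth, norm_zero, zero_div, norm_pos_iff,
      ← A.coord_p h]
    exact fun heq => hzp ((A.coord h).injOn hz (A.p_mem h) heq)
  -- The product (z - p) f, completed by the residue, is holomorphic at p. Its divided difference at
  -- p is f minus the polar part.
  set Φ : ℂ → ℂ :=
    Function.update (fun z => (z - A.p h) * ω.f (Γ.vert h) z) (A.p h) (sign h * c) with hΦ
  have hnhds := (A.coord h).open_source.mem_nhds (A.p_mem h)
  have hΦd : DifferentiableOn ℂ Φ (A.coord h).source := by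
    refine (differentiableOn_compl_singleton_and_continuousAt_iff hnhds).1 ⟨?_, ?_⟩
    · refine DifferentiableOn.congr (f := fun z => (z - A.p h) * ω.f (Γ.vert h) z) ?_
        fun z hz => Function.update_of_ne hz.2 _ _
      exact DifferentiableOn.mul (by fun_prop) ((ω.holo _).mono hsm)
    · exact continuousAt_update_same.2 (hc h.2)
  refine ⟨fun z => 2 * Real.pi * I * dslope Φ (A.p h) z,
    ((differentiableOn_dslope hnhds).2 hΦd).const_mul _, fun z hz hzB => ?_⟩
  have hzp : z ≠ A.p h := by
    rintro rfl
    exact hzB ⟨0, by simp [hth], A.symm_zero h⟩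
  have hzp' := sub_ne_zero.2 hzp
  rw [ω.singularPart_of_eq_zero hρ hth (hc (!h.2)) hr hr2]
  beta_reduce
  rw [dslope_of_ne _ hzp, slope_def_field, hΦ,
    Function.update_self, Function.update_of_ne hzp, show sign (h.1, !h.2) = -sign h from sign_opp h]
  field_simp

theorem exists_extension_of_ne_zero (hρ : 0 < ρ) {h : E × Bool} (hth : t h.1 ≠ 0)
    {r : ℝ} (hr1 : ‖t h.1‖ / ρ < r) (hr2 : r < ρ) :
    ∃ (U : Set ℂ) (g : ℂ → ℂ), IsOpen U ∧ U ⊆ (A.coord h).source ∧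
      (A.coord h).symm '' closedBall 0 (‖t h.1‖ / r) ⊆ U ∧ DifferentiableOn ℂ g U ∧
      ∀ z ∈ U, z ∉ (A.coord h).symm '' closedBall 0 (‖t h.1‖ / r) →
        2 * Real.pi * I * ω.f (Γ.vert h) z - ω.singularPart r h z = g z := by
  have hr : 0 < r := (div_nonneg (norm_nonneg _) hρ.le).trans_lt hr1
  have hs : ‖t h.1‖ / r < ρ := norm_div_lt hρ hr1
  have hs0 : 0 < ‖t h.1‖ / r := div_pos (norm_pos_iff.2 hth) hr
  have hs1 : ‖t h.1‖ / ρ < ‖t h.1‖ / r := div_lt_div_of_pos_left (norm_pos_iff.2 hth) hr hr2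
  -- Cauchy's formula on |t|/r < |w| < R: the inner integral is the singular part, and the outer one
  -- is holomorphic in all of |z_h| < R.
  obtain ⟨R, hR1, hR2⟩ := exists_between hs
  refine ⟨(A.coord h).source ∩ A.coord h ⁻¹' ball 0 R,
    fun z => -∮ w in C(0, R), ω.pull h w / (z - (A.coord h).symm w),
    (A.coord h).isOpen_inter_preimage isOpen_ball, Set.inter_subset_left, ?_, ?_, ?_⟩
  · intro z hz
    obtain ⟨hz1, hz2⟩ := (A.mem_symm_image hs).1 hz
    exact ⟨hz1, by simpa using hz2.trans_lt hR1⟩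
  · refine (differentiableOn_circleIntegral_div_sub (hs0.trans hR1).le
      (ω.continuousOn_pull (hs1.trans hR1) hR2)
      ((A.symm_differentiableOn h).continuousOn.mono fun w hw => ?_)
      ((A.coord h).isOpen_inter_preimage isOpen_ball) fun w hw hwU => ?_).neg
    all_goals simp only [mem_sphere, dist_zero_right] at hw
    · simpa [hw] using hR2
    · have := hwU.2
      rw [Set.mem_preimage, A.coord_symm (hw.trans_lt hR2), mem_ball, dist_zero_right] at this
      linarith
  · rintro z ⟨hz, hzR⟩ hzB
    have hzR' : ‖A.coord h z‖ < R := by simpa using hzR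
    have hzs : ‖t h.1‖ / r < ‖A.coord h z‖ := by
      by_contra! hle
      exact hzB ((A.mem_symm_image hs).2 ⟨hz, hle⟩)
    have hzρ : ‖A.coord h z‖ < ρ := A.norm_coord_lt hz
    set w₀ := A.coord h z with hw₀
    have hzw : (A.coord h).symm w₀ = z := (A.coord h).left_inv hz
    -- By injectivity of ψ the quotient (ψ(w) - ψ(w₀))/(w - w₀) has no zero, so the kernel 1/(z -
    -- ψ(w)) becomes a holomorphic factor times the Cauchy kernel 1/(w - w₀).
    have hne : ∀ w ∈ ball (0 : ℂ) ρ, dslope (A.coord h).symm w₀ w ≠ 0 := by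
      intro w hw
      by_cases hww : w = w₀
      · rw [hww, dslope_same]
        exact A.deriv_symm_ne_zero hzρ
      · rw [dslope_of_ne _ hww, slope_def_field]
        exact div_ne_zero (sub_ne_zero.2 fun heq =>
          hww (A.symm_injOn h hw (by simpa using hzρ) heq)) (sub_ne_zero.2 hww)
    have hslope : DifferentiableOn ℂ (dslope (A.coord h).symm w₀) (ball 0 ρ) :=
      (differentiableOn_dslope (isOpen_ball.mem_nhds (by simpa using hzρ))).2
        (A.symm_differentiableOn h)
    have hH : DifferentiableOn ℂ (fun w => ω.pull h w / dslope (A.coord h).symm w₀ w)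
        {w | ‖t h.1‖ / ρ < ‖w‖ ∧ ‖w‖ < ρ} := by
      have hsub : {w : ℂ | ‖t h.1‖ / ρ < ‖w‖ ∧ ‖w‖ < ρ} ⊆ ball 0 ρ := fun w hw => by
        simpa using hw.2
      exact (ω.differentiableOn_pull h).div (hslope.mono hsub) fun w hw => hne w (hsub hw)
    have key := circleIntegral_div_sub_of_differentiableOn_annulus hH hs0 hs1 hR2 hzs hzR'
    have hcircle : ∀ s : ℝ, 0 < s → s < ρ → s ≠ ‖w₀‖ →
        (∮ w in C(0, s), ω.pull h w / dslope (A.coord h).symm w₀ w / (w - w₀))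
          = -∮ w in C(0, s), ω.pull h w / (z - (A.coord h).symm w) := by
      intro s h0 hsρ hsne
      rw [← neg_one_mul, ← circleIntegral.integral_const_mul]
      refine circleIntegral.integral_congr h0.le fun w hw => ?_
      simp only [mem_sphere, dist_zero_right] at hw
      have hww : w ≠ w₀ := by
        rintro rfl
        exact hsne hw.symm
      have hww' := sub_ne_zero.2 hww
      rw [div_div, dslope_of_ne _ hww, slope_def_field, div_mul_cancel₀ _ hww', hzw,
        ← neg_sub z, div_neg, neg_one_mul]
    rw [hcircle R (hs0.trans hR1) hR2 hzR'.ne', hcircle _ hs0 hs hzs.ne, dslope_same, pull, hzw,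
      mul_div_cancel_right₀ _ (A.deriv_symm_ne_zero hzρ)] at key
    rw [ω.singularPart_of_ne_zero hρ hth hr1 hr2, ← key]
    ring

theorem exists_extension (hρ : 0 < ρ) (h : E × Bool) {r : ℝ}
    (hr1 : ‖t h.1‖ / ρ < r) (hr2 : r < ρ) :
    ∃ (U : Set ℂ) (g : ℂ → ℂ), IsOpen U ∧ U ⊆ (A.coord h).source ∧
      (A.coord h).symm '' closedBall 0 (‖t h.1‖ / r) ⊆ U ∧ DifferentiableOn ℂ g U ∧
      ∀ z ∈ U, z ∉ (A.coord h).symm '' closedBall 0 (‖t h.1‖ / r) →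
        2 * Real.pi * I * ω.f (Γ.vert h) z - ω.singularPart r h z = g z := by
  by_cases hth : t h.1 = 0
  · have hr : 0 < r := (div_nonneg (norm_nonneg _) hρ.le).trans_lt hr1
    obtain ⟨g, hg1, hg2⟩ := ω.exists_extension_of_eq_zero hρ hth hr hr2
    exact ⟨_, g, (A.coord h).open_source, subset_rfl,
      fun z hz => ((A.mem_symm_image (norm_div_lt hρ hr1)).1 hz).1, hg1, hg2⟩
  · exact ω.exists_extension_of_ne_zero hρ hth hr1 hr2

/-- On each sphere, `2πi ω` is the sum of its singular parts. -/
theorem eq_sum_singularPart {k : ℕ} (hΓ : Γ.DegreeLE k) (hρ : 0 < ρ) {r : ℝ}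
    (hr1 : ∀ e, ‖t e‖ / ρ < r) (hr2 : r < ρ) {v : V} {s : Finset (E × Bool)}
    (hs : ∀ h, h ∈ s ↔ Γ.vert h = v) {z : ℂ}
    (hz : ∀ h ∈ s, ¬ (z ∈ (A.coord h).source ∧ ‖A.coord h z‖ ≤ ‖t h.1‖ / r)) :
    2 * Real.pi * I * ω.f v z = ∑ h ∈ s, ω.singularPart r h z := by
  have ht : ∀ e, ‖t e‖ < ρ ^ 2 := fun e => by
    have := (hr1 e).trans hr2
    rw [div_lt_iff₀ hρ] at this
    nlinarith
  choose U g hU hUs hBU hg hfg using fun h => ω.exists_extension hρ h (hr1 h.1) hr2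
  have himage : ∀ h z, z ∉ (A.coord h).symm '' closedBall 0 (‖t h.1‖ / r) ↔
      ¬ (z ∈ (A.coord h).source ∧ ‖A.coord h z‖ ≤ ‖t h.1‖ / r) := fun h z =>
    not_congr (A.mem_symm_image (norm_div_lt hρ (hr1 h.1)))
  refine eqOn_sum_of_singular_parts s
    (fun h => (A.coord h).symm '' closedBall 0 (‖t h.1‖ / r)) U
    (fun h _ => (A.isCompact_symm_image h (norm_div_lt hρ (hr1 h.1))).isClosed)
    (fun h _ => hU h) (fun h _ => hBU h) ?_ (f := fun z => 2 * Real.pi * I * ω.f v z) ?_ ?_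
    (fun h _ => ω.differentiableOn_singularPart hρ (hr1 h.1) hr2)
    (fun h _ => ω.tendsto_singularPart hρ (hr1 h.1) hr2) (fun h _ => hg h) ?_
    (fun h _ => A.isCompact_symm_image h (norm_div_lt hρ (hr1 h.1)))
    (fun h hh => (himage h z).2 (hz h hh))
  · intro h hh h' hh' hne
    exact (A.disjoint h h' hne (((hs h).1 hh).trans ((hs h').1 hh').symm)).mono (hUs h) (hUs h')
  · intro z hz
    refine (ω.differentiableAt hΓ hρ ht fun h hv hrem => ?_).const_mul _
    have hr : 0 < r := (div_nonneg (norm_nonneg _) hρ.le).trans_lt (hr1 h.1)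
    refine (himage h z).1 (hz h ((hs h).2 hv)) ⟨hrem.1, hrem.2.trans ?_⟩
    exact div_le_div_of_nonneg_left (norm_nonneg _) hr hr2.le
  · simpa using (ω.tendsto_f v).const_mul (2 * Real.pi * I : ℂ)
  · intro h hh z hzU hzB
    have hv := (hs h).1 hh
    subst hv
    exact hfg h z hzU hzB

end RegularDifferential

end AdmissibleCoordinates

end OpeningNodes

/-! ### Choice of constants and the self-improving estimate. -/

/-- Take X to be the supremum and absorb X/2; this needs the supremum to be finite. -/
theorem le_two_mul_of_self_improving {ι : Type*} {a : ι → ℝ} (ha : BddAbove (Set.range a)) {K : ℝ}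
    (h : ∀ X, (∀ i, a i ≤ X) → ∀ i, a i ≤ K + X / 2) (i : ι) : a i ≤ 2 * K := by
  have : Nonempty ι := ⟨i⟩
  have h1 : iSup a ≤ K + iSup a / 2 := ciSup_le (h _ (le_ciSup ha))
  have h2 := le_ciSup ha i
  linarith

namespace OpeningNodes

open Metric Complex

/-- Conditions on the radius `r` of a circle in the disks and on a bound `T` for the parameters
of the nodes. -/
structure NeckConstants (k : ℕ) (ρ c₁ c₂ r T : ℝ) : Prop where
  rho_pos : 0 < ρ
  c₁_pos : 0 < c₁
  c₂_pos : 0 < c₂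
  r_pos : 0 < r
  T_pos : 0 < T
  r_le : r ≤ ρ / 2
  mul_r_lt : c₂ * r < c₁ * ρ
  T_lt : T < r ^ 2
  mul_T_le : 2 * c₂ * T ≤ c₁ * r ^ 2
  T_le_sq : T ≤ (c₁ * r / (2 * c₂)) ^ 2
  contraction : c₂ * (2 * (k + 1) * (4 * Real.pi * c₂ / (c₁ * r) ^ 2 * T)) ≤ 1 / 2

/-- The constant of the estimate of a regular differential on the necks. -/
noncomputable def neckBound (k : ℕ) (c₁ c₂ r T : ℝ) : ℝ :=
  2 * k * (1 / (c₁ * r) + 4 * Real.pi * c₂ * T * (2 * (2 * k * c₂ / (c₁ * r))) / (c₁ * r) ^ 2)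
    + 4 * Real.pi * c₂ * (2 * (2 * k * c₂ / (c₁ * r))) / c₁ ^ 2

/-- The radius r puts the circle |w| = r inside both |w| ≤ ρ/2, where ψ' is controlled, and the disk
of radius c₁ρ around p. Then T is taken so small that |t|/r < r, that ψ(t/w) is at most half as far
from p as the points z in use, and that the feedback through the necks has factor at most 1/2. -/
theorem exists_neckConstants (k : ℕ) {ρ c₁ c₂ : ℝ} (hρ : 0 < ρ) (hc₁ : 0 < c₁) (hc₂ : 0 < c₂) :
    ∃ r T : ℝ, NeckConstants k ρ c₁ c₂ r T := by
  obtain ⟨r, hr⟩ : ∃ r, r = ρ * c₁ / (2 * (c₁ + c₂)) := ⟨_, rfl⟩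
  have hr0 : 0 < r := by rw [hr]; positivity
  have hk : (0 : ℝ) < c₂ * (2 * (k + 1) * (4 * Real.pi * c₂ / (c₁ * r) ^ 2)) := by
    have := Real.pi_pos
    positivity
  have h1 : 0 < r ^ 2 / 2 := by positivity
  have h2 : 0 < c₁ * r ^ 2 / (2 * c₂) := by positivity
  have h3 : 0 < (c₁ * r / (2 * c₂)) ^ 2 := by positivity
  have h4 : 0 < 1 / 2 / (c₂ * (2 * (k + 1) * (4 * Real.pi * c₂ / (c₁ * r) ^ 2))) := by positivity
  obtain ⟨T, hT0, hT⟩ := exists_between (lt_min (lt_min h1 h2) (lt_min h3 h4))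
  simp only [lt_min_iff] at hT
  obtain ⟨⟨hT1, hT2⟩, hT3, hT4⟩ := hT
  refine ⟨r, T, hρ, hc₁, hc₂, hr0, hT0, ?_, ?_, by linarith, ?_, hT3.le, ?_⟩
  · rw [hr, div_le_div_iff₀ (by positivity) (by positivity)]
    nlinarith [mul_pos hρ hc₂]
  · rw [hr, mul_div_assoc', div_lt_iff₀ (by positivity)]
    have := mul_pos hc₁ hρ
    nlinarith [mul_pos this hc₁, mul_pos this hc₂]
  · rw [lt_div_iff₀ (by positivity)] at hT2
    linarith
  · rw [lt_div_iff₀ hk] at hT4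
    linarith

namespace NeckConstants

variable {k : ℕ} {ρ c₁ c₂ r T : ℝ} (N : NeckConstants k ρ c₁ c₂ r T)

include N

theorem r_lt : r < ρ := by linarith [N.r_le, N.rho_pos]

theorem norm_div_rho_lt {τ : ℂ} (hτ : ‖τ‖ ≤ T) : ‖τ‖ / ρ < r := by
  rw [div_lt_iff₀ N.rho_pos]
  have h1 := N.T_lt
  have h2 := N.r_lt
  nlinarith [N.r_pos]

theorem norm_div_r_lt {τ : ℂ} (hτ : ‖τ‖ ≤ T) : ‖τ‖ / r < r := by
  rw [div_lt_iff₀ N.r_pos]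
  have h1 := N.T_lt
  nlinarith [N.r_pos]

theorem mul_norm_div_le {τ : ℂ} (hτ : ‖τ‖ ≤ T) : 2 * c₂ * (‖τ‖ / r) ≤ c₁ * r := by
  rw [← mul_div_assoc, div_le_iff₀ N.r_pos]
  have h1 := N.mul_T_le
  nlinarith [N.c₂_pos]

theorem mul_norm_div_le_sqrt {τ : ℂ} (hτ : ‖τ‖ ≤ T) :
    2 * c₂ * (‖τ‖ / r) ≤ c₁ * Real.sqrt ‖τ‖ := by
  have hc₂ := N.c₂_pos
  have h1 : Real.sqrt ‖τ‖ ≤ c₁ * r / (2 * c₂) :=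
    Real.sqrt_le_iff.2 ⟨by have := N.c₁_pos; have := N.r_pos; positivity, hτ.trans N.T_le_sq⟩
  rw [le_div_iff₀ (by positivity)] at h1
  have h2 := Real.mul_self_sqrt (norm_nonneg τ)
  rw [← mul_div_assoc, div_le_iff₀ N.r_pos]
  nlinarith [Real.sqrt_nonneg ‖τ‖]

theorem sqrt_lt {τ : ℂ} (hτ : ‖τ‖ ≤ T) : Real.sqrt ‖τ‖ < r :=
  (Real.sqrt_lt' N.r_pos).2 (hτ.trans_lt N.T_lt)

theorem mul_le_half {X : ℝ} (hX : 0 ≤ X) {m : ℝ} (hm : m ≤ 2 * (k + 1)) :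
    c₂ * (m * (4 * Real.pi * c₂ * T * X / (c₁ * r) ^ 2)) ≤ X / 2 := by
  have h1 := N.contraction
  have hc₂ := N.c₂_pos
  have hT := N.T_pos
  have hc₁ := N.c₁_pos
  have hr := N.r_pos
  have hpi := Real.pi_pos
  calc c₂ * (m * (4 * Real.pi * c₂ * T * X / (c₁ * r) ^ 2))
      ≤ c₂ * ((2 * (k + 1)) * (4 * Real.pi * c₂ * T * X / (c₁ * r) ^ 2)) := by gcongr
    _ = c₂ * (2 * (k + 1) * (4 * Real.pi * c₂ / (c₁ * r) ^ 2 * T)) * X := by ring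
    _ ≤ 1 / 2 * X := by gcongr
    _ = X / 2 := by ring

theorem neckBound_nonneg :
    0 ≤ neckBound k c₁ c₂ r T := by
  have hr := N.r_pos
  have hc₁ := N.c₁_pos
  have hc₂ := N.c₂_pos
  have hT := N.T_pos
  have hpi := Real.pi_pos
  unfold neckBound
  positivity

end NeckConstants

namespace AdmissibleCoordinates

namespace RegularDifferential

variable {V E : Type*} {Γ : OrientedMultigraph V E} {ρ c₁ c₂ : ℝ}
  {A : AdmissibleCoordinates Γ ρ c₁ c₂} {t : E → ℂ} (ω : A.RegularDifferential t)

theorem norm_two_pi_I_mul (x : ℂ) : ‖2 * Real.pi * I * x‖ = 2 * Real.pi * ‖x‖ := by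
  simp [abs_of_pos Real.pi_pos]

theorem norm_pull_le (hρ : 0 < ρ) (hc₂ : 0 < c₂) {h : E × Bool} {w : ℂ} (hw : ‖w‖ ≤ ρ / 2) :
    ‖ω.pull h w‖ ≤ c₂ * ‖2 * Real.pi * I * ω.f (Γ.vert h) ((A.coord h).symm w)‖ := by
  rw [norm_two_pi_I_mul, pull, norm_mul]
  have h1 := A.norm_deriv_symm_le hρ hc₂ (h := h) hw
  have h2 := norm_nonneg (ω.f (Γ.vert h) ((A.coord h).symm w))
  have h3 := Real.pi_gt_three
  calc _ ≤ ‖ω.f (Γ.vert h) ((A.coord h).symm w)‖ * (3 * c₂) := by gcongr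
    _ = c₂ * (3 * ‖ω.f (Γ.vert h) ((A.coord h).symm w)‖) := by ring
    _ ≤ _ := by gcongr; linarith

variable {k : ℕ} {r T : ℝ}

/-- With γ = ψ(t/w), the kernels 1/(z - γ) and 1/(z - p) differ by (γ - p)/((z - γ)(z - p)). Here |γ
- p| ≤ c₂|t|/r is at most |z - p|/2, and the circle has length 2πr. -/
theorem norm_singularPart_sub_le (N : NeckConstants k ρ c₁ c₂ r T) {h : E × Bool}
    (ht : ‖t h.1‖ ≤ T) {X : ℝ} (hX : ∀ w, ‖w‖ = r → ‖ω.pull (opp h) w‖ ≤ X) {z : ℂ}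
    (hzp : z ≠ A.p h) (hz : 2 * c₂ * (‖t h.1‖ / r) ≤ ‖z - A.p h‖) :
    ‖ω.singularPart r h z - sign h * ω.period h.1 / (z - A.p h)‖
      ≤ 4 * Real.pi * c₂ * ‖t h.1‖ * X / ‖z - A.p h‖ ^ 2 := by
  have hρ := N.rho_pos
  have hr := N.r_pos
  have hr1 := N.norm_div_rho_lt ht
  have hr2 := N.r_lt
  have hs := norm_div_lt hρ hr1
  have hzp' : 0 < ‖z - A.p h‖ := norm_pos_iff.2 (sub_ne_zero.2 hzp)
  set γ : ℂ → ℂ := fun w => (A.coord h).symm (t h.1 / w) with hγ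
  have hγp : ∀ w ∈ sphere (0 : ℂ) r, ‖γ w - A.p h‖ ≤ c₂ * (‖t h.1‖ / r) := by
    intro w hw
    simp only [mem_sphere, dist_zero_right] at hw
    have h1 : ‖t h.1 / w‖ = ‖t h.1‖ / r := by rw [norm_div, hw]
    rw [← h1]
    exact A.symm_upper (h1 ▸ hs)
  have hγz : ∀ w ∈ sphere (0 : ℂ) r, ‖z - A.p h‖ / 2 ≤ ‖z - γ w‖ := by
    intro w hw
    have h1 := hγp w hw
    have h2 : ‖z - A.p h‖ ≤ ‖z - γ w‖ + ‖γ w - A.p h‖ := norm_sub_le_norm_sub_add_norm_sub _ _ _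
    linarith
  have hγz' : ∀ w ∈ sphere (0 : ℂ) r, z - γ w ≠ 0 := fun w hw =>
    norm_pos_iff.1 ((half_pos hzp').trans_le (hγz w hw))
  have hcont : ContinuousOn (ω.pull (opp h)) (sphere 0 r) := ω.continuousOn_pull hr1 hr2
  have heq : ω.singularPart r h z - sign h * ω.period h.1 / (z - A.p h)
      = -∮ w in C(0, r), ω.pull (opp h) w * ((γ w - A.p h) / ((z - γ w) * (z - A.p h))) := by
    have h1 : sign h * ω.period h.1 = -∮ w in C(0, r), ω.pull (opp h) w := by
      have h2 := ω.circleIntegral_pull hρ (opp h) hr1 hr2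
      rw [h2, sign_opp]
      simp [opp]
    rw [h1, singularPart, neg_div, neg_sub_neg, div_eq_inv_mul,
      ← circleIntegral.integral_const_mul, ← circleIntegral.integral_sub, ← neg_one_mul,
      ← circleIntegral.integral_const_mul]
    · refine circleIntegral.integral_congr hr.le fun w hw => ?_
      have h3 := hγz' w hw
      have h4 := sub_ne_zero.2 hzp
      simp only [hγ] at h3 ⊢
      field_simp
      ring
    · exact (continuousOn_const.mul hcont).circleIntegrable hr.le
    · exact (hcont.div (continuousOn_const.sub (continuousOn_symm_div hρ hr1)) hγz').circleIntegrable
        hr.le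
  rw [heq, norm_neg]
  have hX0 : 0 ≤ X := (norm_nonneg _).trans (hX r (by simp [hr.le]))
  have hc₂ := N.c₂_pos
  refine (circleIntegral.norm_integral_le_of_norm_le_const hr.le
    (C := X * (c₂ * (‖t h.1‖ / r) / (‖z - A.p h‖ / 2 * ‖z - A.p h‖))) fun w hw => ?_).trans
    (le_of_eq ?_)
  · rw [norm_mul, norm_div, norm_mul]
    have h1 := hX w (by simpa using hw)
    have h2 := hγp w hw
    have h3 := hγz w hw
    gcongr
  · field_simp
    ring

theorem norm_singularPart_le (N : NeckConstants k ρ c₁ c₂ r T) {h : E × Bool}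
    (ht : ‖t h.1‖ ≤ T) {X a : ℝ} (hX : ∀ w, ‖w‖ = r → ‖ω.pull (opp h) w‖ ≤ X)
    (ha : ‖ω.period h.1‖ ≤ a) {z : ℂ} (hz : c₁ * r ≤ ‖z - A.p h‖) :
    ‖ω.singularPart r h z‖ ≤ a / (c₁ * r) + 4 * Real.pi * c₂ * T * X / (c₁ * r) ^ 2 := by
  have hr := N.r_pos
  have hc₁ := N.c₁_pos
  have hc₂ := N.c₂_pos
  have hT := N.T_pos
  have hcr : 0 < c₁ * r := by positivity
  have hX0 : 0 ≤ X := (norm_nonneg _).trans (hX r (by simp [hr.le]))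
  have ha0 : 0 ≤ a := (norm_nonneg _).trans ha
  have hpi := Real.pi_pos
  have hzp : z ≠ A.p h := by
    rintro rfl
    simp only [sub_self, norm_zero] at hz
    linarith
  have h1 := ω.norm_singularPart_sub_le N ht hX hzp ((N.mul_norm_div_le ht).trans hz)
  have h2 : ‖sign h * ω.period h.1 / (z - A.p h)‖ ≤ a / (c₁ * r) := by
    rw [norm_div, norm_mul, norm_sign, one_mul]
    gcongr
  have h3 : 4 * Real.pi * c₂ * ‖t h.1‖ * X / ‖z - A.p h‖ ^ 2
      ≤ 4 * Real.pi * c₂ * T * X / (c₁ * r) ^ 2 := by gcongr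
  have h4 := norm_le_norm_add_norm_sub' (ω.singularPart r h z)
    (sign h * ω.period h.1 / (z - A.p h))
  linarith

theorem eq_sum_singularPart_of_mem_source (hΓ : Γ.DegreeLE k) (N : NeckConstants k ρ c₁ c₂ r T)
    (ht : ∀ e, ‖t e‖ ≤ T) {h : E × Bool} {z : ℂ} (hz : z ∈ (A.coord h).source)
    (hzt : ‖t h.1‖ / r < ‖A.coord h z‖) :
    2 * Real.pi * I * ω.f (Γ.vert h) z
      = ∑ h' ∈ hΓ.halfEdges (Γ.vert h), ω.singularPart r h' z := by
  refine ω.eq_sum_singularPart hΓ N.rho_pos (fun e => N.norm_div_rho_lt (ht e)) N.r_lt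
    (hΓ.mem_halfEdges _) ?_
  rintro h' hh' ⟨hz', hle⟩
  by_cases hne : h = h'
  · subst hne
    linarith
  · exact A.notMem_source hne ((hΓ.mem_halfEdges _ _).1 hh').symm hz hz'

theorem le_norm_sub_of_mem_source (N : NeckConstants k ρ c₁ c₂ r T) {h h' : E × Bool}
    (hne : h ≠ h') (hv : Γ.vert h = Γ.vert h') {z : ℂ} (hz : z ∈ (A.coord h).source) :
    c₁ * r ≤ ‖z - A.p h'‖ :=
  (mul_le_mul_of_nonneg_left N.r_lt.le N.c₁_pos.le).trans
    (A.le_norm_sub_of_notMem N.c₁_pos (A.notMem_source hne hv hz))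

/-- On |w| = r all centers of disks at the vertex are at distance at least c₁r: its own by
admissibility, the others by disjointness of the disks. So each of the at most 2k singular parts is
controlled by the periods and a small multiple of X. -/
theorem norm_pull_le_of_norm_pull_le (hΓ : Γ.DegreeLE k) (N : NeckConstants k ρ c₁ c₂ r T)
    (ht : ∀ e, ‖t e‖ ≤ T) {a X : ℝ} (ha : ∀ e, ‖ω.period e‖ ≤ a)
    (hX : ∀ h w, ‖w‖ = r → ‖ω.pull h w‖ ≤ X) {h : E × Bool} {w : ℂ} (hw : ‖w‖ = r) :
    ‖ω.pull h w‖ ≤ 2 * k * c₂ * a / (c₁ * r) + X / 2 := by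
  have hr := N.r_pos
  have hc₁ := N.c₁_pos
  have hc₂ := N.c₂_pos
  have hT := N.T_pos
  have hpi := Real.pi_pos
  have hX0 : 0 ≤ X := (norm_nonneg _).trans (hX h w hw)
  have ha0 : 0 ≤ a := (norm_nonneg _).trans (ha h.1)
  have hwρ : ‖w‖ < ρ := hw.trans_lt N.r_lt
  have hz := A.symm_mem (h := h) hwρ
  have h1 := ω.norm_pull_le N.rho_pos N.c₂_pos (h := h) (hw.trans_le N.r_le)
  rw [ω.eq_sum_singularPart_of_mem_source hΓ N ht hz
    (by rw [A.coord_symm hwρ, hw]; exact N.norm_div_r_lt (ht _))] at h1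
  have h2 : ‖∑ h' ∈ hΓ.halfEdges (Γ.vert h), ω.singularPart r h' ((A.coord h).symm w)‖
      ≤ 2 * k * (a / (c₁ * r) + 4 * Real.pi * c₂ * T * X / (c₁ * r) ^ 2) := by
    refine (norm_sum_le_of_le _ fun h' hh' => ω.norm_singularPart_le N (ht _) (hX _) (ha _)
      ?_).trans ?_
    · by_cases hne : h = h'
      · subst hne
        rw [← hw]
        exact A.symm_lower hwρ
      · exact le_norm_sub_of_mem_source N hne ((hΓ.mem_halfEdges _ _).1 hh').symm hz
    · rw [Finset.sum_const, nsmul_eq_mul]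
      gcongr
      exact hΓ.card_halfEdges_le _
  have h3 := N.mul_le_half hX0 (m := 2 * k) (by linarith)
  calc ‖ω.pull h w‖
      ≤ c₂ * (2 * k * (a / (c₁ * r) + 4 * Real.pi * c₂ * T * X / (c₁ * r) ^ 2)) :=
        h1.trans (by gcongr)
    _ = 2 * k * c₂ * a / (c₁ * r)
        + c₂ * (2 * k * (4 * Real.pi * c₂ * T * X / (c₁ * r) ^ 2)) := by ring
    _ ≤ _ := by gcongr

end RegularDifferential

end AdmissibleCoordinates

end OpeningNodes

/-! ### A priori bound from the finite norm, and the estimate on the necks. -/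

namespace OpeningNodes

open Metric Complex

namespace AdmissibleCoordinates

namespace RegularDifferential

variable {V E : Type*} {Γ : OrientedMultigraph V E} {ρ c₁ c₂ : ℝ}
  {A : AdmissibleCoordinates Γ ρ c₁ c₂} {t : E → ℂ} (ω : A.RegularDifferential t)
  {k : ℕ} {r T : ℝ}

theorem notMem_source_of_mem_closedBall (N : NeckConstants k ρ c₁ c₂ r T) {h h' : E × Bool}
    (hne : h ≠ h') (hv : Γ.vert h = Γ.vert h') {z : ℂ} (hz : z ∈ closedBall (A.p h) (c₁ * ρ)) :
    z ∉ (A.coord h').source := by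
  have h1 : z ∈ closure (A.coord h).source := by
    rw [← closure_ball _ (mul_pos N.c₁_pos N.rho_pos).ne'] at hz
    exact closure_mono (A.ball_subset_source N.c₁_pos h) hz
  exact Set.disjoint_left.1
    ((A.disjoint h h' hne hv).closure_left (A.coord h').open_source) h1

theorem notMem_symm_image_of_mem_sphere (N : NeckConstants k ρ c₁ c₂ r T) {h h' : E × Bool}
    (hv : Γ.vert h = Γ.vert h') {s : ℝ} (hs : c₂ * s < c₁ * ρ) {z : ℂ}
    (hz : z ∈ sphere (A.p h) (c₁ * ρ)) :
    ¬ (z ∈ (A.coord h').source ∧ ‖A.coord h' z‖ ≤ s) := by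
  rintro ⟨h1, h2⟩
  by_cases hne : h = h'
  · subst hne
    have h3 := A.upper h z h1
    rw [← dist_eq_norm, mem_sphere.1 hz] at h3
    have := mul_le_mul_of_nonneg_left h2 N.c₂_pos.le
    linarith
  · exact notMem_source_of_mem_closedBall N hne hv (sphere_subset_closedBall hz) h1

/-- On the circle of radius `c₁ρ` around the center of a disk, a differential of finite norm is
bounded by its norm. -/
theorem FiniteNorm.exists_bound_sphere {ω : A.RegularDifferential t}
    (N : NeckConstants k ρ c₁ c₂ r T) (ht : ∀ e, ‖t e‖ ≤ T) {η : ℝ} (hη : η ≤ ρ * c₁)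
    (hω : ω.FiniteNorm η) :
    ∃ M : ℝ, ∀ h, ∀ z ∈ sphere (A.p h) (c₁ * ρ), ‖ω.f (Γ.vert h) z‖ ≤ M := by
  obtain ⟨M, hM⟩ := hω
  refine ⟨M, fun h z hz => hM _ z (fun h' hv => ?_) fun h' hv => ?_⟩
  · refine notMem_symm_image_of_mem_sphere N hv.symm ?_ hz
    have := mul_lt_mul_of_pos_left (N.norm_div_rho_lt (ht h'.1)) N.c₂_pos
    exact this.trans N.mul_r_lt
  · refine (hη.trans_eq (mul_comm _ _)).trans ?_
    by_cases hne : h = h'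
    · subst hne
      rw [← dist_eq_norm, mem_sphere.1 hz]
    · exact A.le_norm_sub_of_notMem N.c₁_pos
        (notMem_source_of_mem_closedBall N hne hv.symm (sphere_subset_closedBall hz))

/-- The bound of `ω` in one disk in terms of its norm and of its values at the other side of the
neck. -/
theorem norm_pull_le_opp (hΓ : Γ.DegreeLE k) (N : NeckConstants k ρ c₁ c₂ r T)
    (ht : ∀ e, ‖t e‖ ≤ T) {a M X : ℝ} (ha : ∀ e, ‖ω.period e‖ ≤ a) {h : E × Bool}
    (hM : ∀ z ∈ sphere (A.p h) (c₁ * ρ), ‖ω.f (Γ.vert h) z‖ ≤ M)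
    (hX : ∀ w, ‖w‖ = r → ‖ω.pull (opp h) w‖ ≤ X) {w : ℂ} (hw : ‖w‖ = r) :
    ‖ω.pull h w‖ ≤ c₂ * (2 * Real.pi * M + 2 * (a / (c₁ * r))) + X / 2 := by
  classical
  have hr := N.r_pos
  have hc₁ := N.c₁_pos
  have hc₂ := N.c₂_pos
  have hρ := N.rho_pos
  have hX0 : 0 ≤ X := (norm_nonneg _).trans (hX w hw)
  have hwρ : ‖w‖ < ρ := hw.trans_lt N.r_lt
  set s := (hΓ.halfEdges (Γ.vert h)).erase h with hs
  have hmem : h ∈ hΓ.halfEdges (Γ.vert h) := (hΓ.mem_halfEdges _ _).2 rfl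
  have hQ : ∀ z, c₁ * r ≤ ‖z - A.p h‖ → ‖ω.singularPart r h z‖
      ≤ a / (c₁ * r) + 4 * Real.pi * c₂ * T * X / (c₁ * r) ^ 2 := fun z hz =>
    ω.norm_singularPart_le N (ht _) hX (ha _) hz
  set q := a / (c₁ * r) + 4 * Real.pi * c₂ * T * X / (c₁ * r) ^ 2 with hq
  have hd : DifferentiableOn ℂ (fun z => ∑ h' ∈ s, ω.singularPart r h' z)
      (closedBall (A.p h) (c₁ * ρ)) := by
    refine DifferentiableOn.fun_sum fun h' hh' => ?_
    obtain ⟨hne, hh'⟩ := Finset.mem_erase.1 hh'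
    refine (ω.differentiableOn_singularPart hρ (N.norm_div_rho_lt (ht h'.1)) N.r_lt).mono
      fun z hz hzB => ?_
    exact notMem_source_of_mem_closedBall N (Ne.symm hne) ((hΓ.mem_halfEdges _ _).1 hh').symm hz
      ((A.mem_symm_image (norm_div_lt hρ (N.norm_div_rho_lt (ht h'.1)))).1 hzB).1
  -- The other singular parts are holomorphic on this ball, so the maximum principle reduces to its
  -- boundary. There their sum is 2πi f minus the singular part of h, and f is bounded by M.
  have hbound : ∀ z ∈ closedBall (A.p h) (c₁ * ρ),
      ‖∑ h' ∈ s, ω.singularPart r h' z‖ ≤ 2 * Real.pi * M + q := by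
    intro z hz
    have hc0 : c₁ * ρ ≠ 0 := (mul_pos hc₁ hρ).ne'
    refine Complex.norm_le_of_forall_mem_frontier_norm_le isBounded_ball
      (hd.diffContOnCl_ball subset_rfl) ?_ (by rwa [closure_ball _ hc0])
    intro z hz
    rw [frontier_ball _ hc0] at hz
    have h1 : 2 * Real.pi * I * ω.f (Γ.vert h) z
        = ∑ h' ∈ hΓ.halfEdges (Γ.vert h), ω.singularPart r h' z := by
      refine ω.eq_sum_singularPart hΓ hρ (fun e => N.norm_div_rho_lt (ht e)) N.r_lt
        (hΓ.mem_halfEdges _) fun h' hh' => notMem_symm_image_of_mem_sphere N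
          ((hΓ.mem_halfEdges _ _).1 hh').symm ?_ hz
      exact (mul_lt_mul_of_pos_left (N.norm_div_r_lt (ht h'.1)) hc₂).trans N.mul_r_lt
    rw [← Finset.add_sum_erase _ _ hmem, ← sub_eq_iff_eq_add'] at h1
    rw [hs, ← h1]
    refine norm_sub_le_of_le ?_ (hQ z ?_)
    · rw [norm_two_pi_I_mul]
      have := hM z hz
      have := Real.pi_pos
      gcongr
    · rw [← dist_eq_norm, mem_sphere.1 hz]
      have := N.r_lt
      gcongr
  have hz := A.symm_mem (h := h) hwρ
  have hzp : (A.coord h).symm w ∈ closedBall (A.p h) (c₁ * ρ) := by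
    rw [mem_closedBall, dist_eq_norm]
    have := A.symm_upper (h := h) hwρ
    rw [hw] at this
    exact this.trans N.mul_r_lt.le
  have h1 := ω.norm_pull_le hρ hc₂ (h := h) (hw.trans_le N.r_le)
  rw [ω.eq_sum_singularPart_of_mem_source hΓ N ht hz
    (by rw [A.coord_symm hwρ, hw]; exact N.norm_div_r_lt (ht _)),
    ← Finset.add_sum_erase _ _ hmem] at h1
  have h2 := norm_add_le_of_le (hQ ((A.coord h).symm w) (by rw [← hw]; exact A.symm_lower hwρ))
    (hbound _ hzp)
  have h3 := N.mul_le_half hX0 (m := 2) (by have : (0 : ℝ) ≤ k := k.cast_nonneg; linarith)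
  calc ‖ω.pull h w‖ ≤ c₂ * (q + (2 * Real.pi * M + q)) := h1.trans (by gcongr)
    _ = c₂ * (2 * Real.pi * M + 2 * (a / (c₁ * r)))
        + c₂ * (2 * (4 * Real.pi * c₂ * T * X / (c₁ * r) ^ 2)) := by rw [hq]; ring
    _ ≤ _ := by gcongr

/-- For one edge the maxima m, m' over the two circles are finite by compactness and satisfy m ≤ K +
m'/2 and m' ≤ K + m/2. Hence m ≤ 2K, with K independent of the edge. -/
theorem FiniteNorm.exists_bound_pull {ω : A.RegularDifferential t} (hΓ : Γ.DegreeLE k)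
    (N : NeckConstants k ρ c₁ c₂ r T) (ht : ∀ e, ‖t e‖ ≤ T) {η : ℝ} (hη : η ≤ ρ * c₁)
    (hω : ω.FiniteNorm η) {a : ℝ} (ha : ∀ e, ‖ω.period e‖ ≤ a) :
    ∃ K : ℝ, ∀ h w, ‖w‖ = r → ‖ω.pull h w‖ ≤ K := by
  obtain ⟨M, hM⟩ := hω.exists_bound_sphere N ht hη
  have hmax : ∀ h, ∃ w₀ : ℂ, ‖w₀‖ = r ∧ ∀ w, ‖w‖ = r → ‖ω.pull h w‖ ≤ ‖ω.pull h w₀‖ := by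
    intro h
    obtain ⟨w₀, hw₀, hmax⟩ := (isCompact_sphere (0 : ℂ) r).exists_isMaxOn
      (NormedSpace.sphere_nonempty.2 N.r_pos.le)
      (ω.continuousOn_pull (h := h) (N.norm_div_rho_lt (ht h.1)) N.r_lt).norm
    exact ⟨w₀, by simpa using hw₀, fun w hw => hmax (by simpa using hw)⟩
  choose w₀ hw₀ hmax using hmax
  refine ⟨2 * (c₂ * (2 * Real.pi * M + 2 * (a / (c₁ * r)))), fun h w hw => ?_⟩
  have h1 := ω.norm_pull_le_opp hΓ N ht ha (hM h) (hmax (opp h)) (hw₀ h)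
  have h2 := ω.norm_pull_le_opp hΓ N ht ha (hM (opp h)) (by rw [opp_opp]; exact hmax h)
    (hw₀ (opp h))
  have h3 := hmax h w hw
  linarith

theorem FiniteNorm.norm_pull_le {ω : A.RegularDifferential t} (hΓ : Γ.DegreeLE k)
    (N : NeckConstants k ρ c₁ c₂ r T) (ht : ∀ e, ‖t e‖ ≤ T) {η : ℝ} (hη : η ≤ ρ * c₁)
    (hω : ω.FiniteNorm η) {a : ℝ} (ha : ∀ e, ‖ω.period e‖ ≤ a) {h : E × Bool} {w : ℂ}
    (hw : ‖w‖ = r) : ‖ω.pull h w‖ ≤ 2 * (2 * k * c₂ * a / (c₁ * r)) := by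
  obtain ⟨K, hK⟩ := hω.exists_bound_pull hΓ N ht hη ha
  have := le_two_mul_of_self_improving (ι := (E × Bool) × {w : ℂ // ‖w‖ = r})
    (a := fun i => ‖ω.pull i.1 i.2‖) (K := 2 * k * c₂ * a / (c₁ * r))
    ⟨K, by rintro _ ⟨i, rfl⟩; exact hK i.1 i.2 i.2.2⟩
    (fun X hX i => ω.norm_pull_le_of_norm_pull_le hΓ N ht ha
      (fun h w hw => hX (h, ⟨w, hw⟩)) i.2.2)
  exact this (h, ⟨w, hw⟩)

/-- The singular part of h supplies the polar term, with an error controlled by |t|/|z - p|² ≤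
1/c₁². The other singular parts at the vertex are centered far from z. -/
theorem FiniteNorm.norm_sub_le {ω : A.RegularDifferential t} (hΓ : Γ.DegreeLE k)
    (N : NeckConstants k ρ c₁ c₂ r T) (ht : ∀ e, ‖t e‖ ≤ T) {η : ℝ} (hη : η ≤ ρ * c₁)
    (hω : ω.FiniteNorm η) {a : ℝ} (ha : ∀ e, ‖ω.period e‖ ≤ a) {h : E × Bool} {z : ℂ}
    (hz : z ∈ (A.coord h).source) (hzp : z ≠ A.p h)
    (hzt : Real.sqrt ‖t h.1‖ ≤ ‖A.coord h z‖) :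
    ‖2 * Real.pi * I * ω.f (Γ.vert h) z - sign h * ω.period h.1 / (z - A.p h)‖
      ≤ neckBound k c₁ c₂ r T * a := by
  classical
  have hr := N.r_pos
  have hc₁ := N.c₁_pos
  have hc₂ := N.c₂_pos
  have hT := N.T_pos
  have hpi := Real.pi_pos
  have ha0 : 0 ≤ a := (norm_nonneg _).trans (ha h.1)
  obtain ⟨X, hX⟩ : ∃ X, X = 2 * (2 * k * c₂ * a / (c₁ * r)) := ⟨_, rfl⟩
  have hpull : ∀ h w, ‖w‖ = r → ‖ω.pull h w‖ ≤ X := fun h w hw =>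
    hX ▸ hω.norm_pull_le hΓ N ht hη ha hw
  have hX0 : 0 ≤ X := by rw [hX]; positivity
  have hmem : h ∈ hΓ.halfEdges (Γ.vert h) := (hΓ.mem_halfEdges _ _).2 rfl
  have hlow : c₁ * Real.sqrt ‖t h.1‖ ≤ ‖z - A.p h‖ :=
    (mul_le_mul_of_nonneg_left hzt hc₁.le).trans (A.lower h z hz)
  -- For t ≠ 0, √|t| < r gives |t|/r < √|t|. For t = 0 the strict inequality says that z is not the
  -- node.
  have hzt' : ‖t h.1‖ / r < ‖A.coord h z‖ := by
    by_cases hth : t h.1 = 0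
    · rw [hth, norm_zero, zero_div, norm_pos_iff, ← A.coord_p h]
      exact fun heq => hzp ((A.coord h).injOn hz (A.p_mem h) heq)
    · refine lt_of_lt_of_le ?_ hzt
      have h1 := Real.sqrt_pos.2 (norm_pos_iff.2 hth)
      have h2 := N.sqrt_lt (ht h.1)
      rw [div_lt_iff₀ hr]
      nlinarith [Real.mul_self_sqrt (norm_nonneg (t h.1))]
  rw [ω.eq_sum_singularPart_of_mem_source hΓ N ht hz hzt', ← Finset.add_sum_erase _ _ hmem,
    add_sub_right_comm]
  have h1 := ω.norm_singularPart_sub_le N (ht h.1) (hpull (opp h)) hzp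
    ((N.mul_norm_div_le_sqrt (ht h.1)).trans hlow)
  have h2 : 4 * Real.pi * c₂ * ‖t h.1‖ * X / ‖z - A.p h‖ ^ 2 ≤ 4 * Real.pi * c₂ * X / c₁ ^ 2 := by
    have hzp' : 0 < ‖z - A.p h‖ := norm_pos_iff.2 (sub_ne_zero.2 hzp)
    have h3 : c₁ ^ 2 * ‖t h.1‖ ≤ ‖z - A.p h‖ ^ 2 := by
      have := pow_le_pow_left₀ (by positivity) hlow 2
      rwa [mul_pow, Real.sq_sqrt (norm_nonneg _)] at this
    rw [div_le_div_iff₀ (by positivity) (by positivity)]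
    calc 4 * Real.pi * c₂ * ‖t h.1‖ * X * c₁ ^ 2
        = 4 * Real.pi * c₂ * X * (c₁ ^ 2 * ‖t h.1‖) := by ring
      _ ≤ _ := by gcongr
  have h4 : ‖∑ h' ∈ (hΓ.halfEdges (Γ.vert h)).erase h, ω.singularPart r h' z‖
      ≤ 2 * k * (a / (c₁ * r) + 4 * Real.pi * c₂ * T * X / (c₁ * r) ^ 2) := by
    refine (norm_sum_le_of_le _ fun h' hh' => ω.norm_singularPart_le N (ht _)
      (hpull (opp h')) (ha _) ?_).trans ?_
    · obtain ⟨hne, hh'⟩ := Finset.mem_erase.1 hh'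
      exact le_norm_sub_of_mem_source N (Ne.symm hne) ((hΓ.mem_halfEdges _ _).1 hh').symm hz
    · rw [Finset.sum_const, nsmul_eq_mul]
      gcongr
      refine le_trans ?_ (hΓ.card_halfEdges_le (Γ.vert h))
      exact_mod_cast Finset.card_le_card (Finset.erase_subset _ _)
  refine (norm_add_le_of_le (h1.trans h2) h4).trans (le_of_eq ?_)
  rw [hX, neckBound]
  ring

end RegularDifferential

end AdmissibleCoordinates

end OpeningNodes

/-! ### Zeros on the glued surface. -/

namespace OpeningNodes

open Metric Complex

namespace AdmissibleCoordinates

namespace RegularDifferential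

variable {V E : Type*} {Γ : OrientedMultigraph V E} {ρ c₁ c₂ : ℝ}
  {A : AdmissibleCoordinates Γ ρ c₁ c₂} {t : E → ℂ} (ω : A.RegularDifferential t)
  {k : ℕ} {r T : ℝ}

theorem vanishesAt_iff_of_inDisk {x : A.Pt t} {h : E × Bool} {z : ℂ} (hx : x.InDisk h z) :
    ω.VanishesAt x ↔ ‖t h.1‖ / ρ < ‖A.coord h z‖ ∧ ω.pull h (A.coord h z) = 0 := by
  obtain ⟨v, pt, hkept⟩ := x
  obtain ⟨hv, hpt, hz⟩ := hx
  simp only at hv hpt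
  subst hv hpt
  have hzρ : ‖A.coord h z‖ < ρ := A.norm_coord_lt hz
  rw [← A.mem_smoothPart_of_mem_source hz, pull, (A.coord h).left_inv hz, mul_eq_zero,
    or_iff_left (A.deriv_symm_ne_zero hzρ)]
  constructor
  · rintro (⟨z', hz', h1, h2⟩ | ⟨hinf, -⟩)
    · obtain rfl := OnePoint.coe_injective hz'
      exact ⟨h1, h2⟩
    · exact absurd hinf (OnePoint.coe_ne_infty z)
  · rintro ⟨h1, h2⟩
    exact Or.inl ⟨z, rfl, h1, h2⟩

/-- Across an open neck the two coefficients differ by the nonzero factor -t/w². At a node both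
sides are false, since nodes are excluded from the smooth part. So zeros are well defined on the
quotient. -/
theorem vanishesAt_iff_of_glue (hρ : 0 < ρ) {x y : A.Pt t} (hxy : A.Glue t x y) :
    ω.VanishesAt x ↔ ω.VanishesAt y := by
  obtain ⟨e, z, z', hx, hy, ⟨hte, hzz⟩ | ⟨hte, rfl, rfl⟩⟩ := hxy
  · rw [ω.vanishesAt_iff_of_inDisk hx, ω.vanishesAt_iff_of_inDisk hy]
    set w := A.coord (e, false) z with hw
    set w' := A.coord (e, true) z' with hw'
    have hw0 : w ≠ 0 := by
      rintro h0
      rw [h0, zero_mul] at hzz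
      exact hte hzz.symm
    have hw'0 : w' ≠ 0 := by
      rintro h0
      rw [h0, mul_zero] at hzz
      exact hte hzz.symm
    have hwρ : ‖w‖ < ρ := A.norm_coord_lt hx.2.2
    have hw'ρ : ‖w'‖ < ρ := A.norm_coord_lt hy.2.2
    have h1 : ‖t e‖ / ρ < ‖w‖ := by
      rw [div_lt_iff₀ hρ, ← hzz, norm_mul]
      exact mul_lt_mul_of_pos_left hw'ρ (norm_pos_iff.2 hw0)
    have h2 : ‖t e‖ / ρ < ‖w'‖ := by
      rw [div_lt_iff₀ hρ, ← hzz, norm_mul, mul_comm]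
      exact mul_lt_mul_of_pos_left hwρ (norm_pos_iff.2 hw'0)
    have h3 : t e / w = w' := by rw [← hzz, mul_div_cancel_left₀ _ hw0]
    rw [ω.pull_false hρ hte h1 hwρ, h3, mul_eq_zero, or_iff_right
      (neg_ne_zero.2 (div_ne_zero hte (pow_ne_zero 2 hw0)))]
    simp only [h1, h2, true_and]
  · rw [ω.vanishesAt_iff_of_inDisk hx, ω.vanishesAt_iff_of_inDisk hy]
    simp [A.coord_p, hte]

theorem vanishesAt_iff_of_toSurface_eq (hρ : 0 < ρ) {x y : A.Pt t}
    (hxy : A.toSurface t x = A.toSurface t y) : ω.VanishesAt x ↔ ω.VanishesAt y := by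
  induction Quot.eqvGen_exact hxy with
  | rel x y h => exact ω.vanishesAt_iff_of_glue hρ h
  | refl => rfl
  | symm x y h ih => exact (ih (Quot.eqvGen_sound h)).symm
  | trans x y z h1 h2 ih1 ih2 =>
    exact (ih1 (Quot.eqvGen_sound h1)).trans (ih2 (Quot.eqvGen_sound h2))

/-- A point of a neck has a representative on the other side. -/
theorem exists_inDisk_opp (hρ : 0 < ρ) {x : A.Pt t} {h : E × Bool} {z : ℂ} (hx : x.InDisk h z)
    (hth : t h.1 ≠ 0) (hz : ‖t h.1‖ / ρ < ‖A.coord h z‖) :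
    ∃ (y : A.Pt t) (z' : ℂ), y.InDisk (opp h) z' ∧ A.toSurface t y = A.toSurface t x ∧
      A.coord (opp h) z' = t h.1 / A.coord h z := by
  have hzρ : ‖A.coord h z‖ < ρ := A.norm_coord_lt hx.2.2
  obtain ⟨h1, h2⟩ := norm_const_div_bounds hρ hz hzρ hth
  have hz0 : A.coord h z ≠ 0 :=
    norm_pos_iff.1 ((div_nonneg (norm_nonneg _) hρ.le).trans_lt hz)
  have hsm := A.symm_mem_smoothPart (t := t) (h := opp h) h2 h1
  let y : A.Pt t := ⟨Γ.vert (opp h), ((A.coord (opp h)).symm (t h.1 / A.coord h z) : ℂ),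
    fun h' hv _ u hu heq => hsm h' hv (OnePoint.coe_injective heq ▸ hu)⟩
  have hy : y.InDisk (opp h) ((A.coord (opp h)).symm (t h.1 / A.coord h z)) :=
    ⟨rfl, rfl, A.symm_mem h2⟩
  have hc := A.coord_symm (h := opp h) h2
  refine ⟨y, _, hy, ?_, hc⟩
  rcases h with ⟨e, _ | _⟩
  · refine (Quot.sound ⟨e, z, _, hx, hy, Or.inl ⟨hth, ?_⟩⟩).symm
    change _ * A.coord (opp (e, false)) _ = _
    rw [hc]
    exact mul_div_cancel₀ _ hz0
  · refine Quot.sound ⟨e, _, z, hy, hx, Or.inl ⟨hth, ?_⟩⟩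
    change A.coord (opp (e, true)) _ * _ = _
    rw [hc]
    exact div_mul_cancel₀ _ hz0

theorem FiniteNorm.zeros_inter_neckAnnulus_eq_empty {ω : A.RegularDifferential t}
    (hΓ : Γ.DegreeLE k) (N : NeckConstants k ρ c₁ c₂ r T) (ht : ∀ e, ‖t e‖ ≤ T) {η : ℝ}
    (hη : η ≤ ρ * c₁) (hω : ω.FiniteNorm η) {a : ℝ} (ha : ∀ e, ‖ω.period e‖ ≤ a) {e : E} {ε : ℝ}
    (he : neckBound k c₁ c₂ r T * ε * a < ‖ω.period e‖) :
    ω.zeros ∩ A.neckAnnulus t e ε = ∅ := by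
  have hρ := N.rho_pos
  have ha0 : 0 ≤ a := (norm_nonneg _).trans (ha e)
  refine Set.eq_empty_iff_forall_notMem.2 ?_
  rintro q ⟨⟨x₀, rfl, hvan₀⟩, ⟨s, x, z, hx, hxq⟩, hdist⟩
  -- No representative of the zero lies in the half |z_e| ≥ √|t| of its disk: there f = 0 turns the
  -- neck estimate into |α_e| ≤ C a |z - p| ≤ C a ε.
  have main : ∀ (s : Bool) (x : A.Pt t) (z : ℂ), x.InDisk (e, s) z →
      A.toSurface t x = A.toSurface t x₀ → ¬ Real.sqrt ‖t e‖ ≤ ‖A.coord (e, s) z‖ := by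
    intro s x z hx hxq hsqrt
    have hvan := (ω.vanishesAt_iff_of_toSurface_eq hρ hxq).2 hvan₀
    obtain ⟨h1, h2⟩ := (ω.vanishesAt_iff_of_inDisk hx).1 hvan
    have hz := hx.2.2
    have hzp : z ≠ A.p (e, s) := by
      rintro rfl
      rw [A.coord_p, norm_zero] at h1
      exact h1.not_ge (div_nonneg (norm_nonneg _) hρ.le)
    have hzp' : 0 < ‖z - A.p (e, s)‖ := norm_pos_iff.2 (sub_ne_zero.2 hzp)
    rw [pull, (A.coord (e, s)).left_inv hz, mul_eq_zero,
      or_iff_left (A.deriv_symm_ne_zero (A.norm_coord_lt hz))] at h2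
    have h3 := hω.norm_sub_le hΓ N ht hη ha hz hzp hsqrt
    rw [h2, mul_zero, zero_sub, norm_neg, norm_div, norm_mul, norm_sign, one_mul,
      div_le_iff₀ hzp'] at h3
    have h4 := hdist s x z hx hxq
    have h5 : neckBound k c₁ c₂ r T * a * ‖z - A.p (e, s)‖
        ≤ neckBound k c₁ c₂ r T * a * ε :=
      mul_le_mul_of_nonneg_left h4 (mul_nonneg N.neckBound_nonneg ha0)
    simp only at h3
    linarith
  have hlt := not_le.1 (main s x z hx hxq)
  have hvan := (ω.vanishesAt_iff_of_toSurface_eq hρ hxq).2 hvan₀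
  obtain ⟨h1, -⟩ := (ω.vanishesAt_iff_of_inDisk hx).1 hvan
  have hte : t e ≠ 0 := by
    intro h0
    rw [h0, norm_zero, Real.sqrt_zero] at hlt
    exact hlt.not_ge (norm_nonneg _)
  -- The coordinate on the other side is t/w with |w| < √|t|, so its modulus is at least √|t|.
  obtain ⟨y, z', hy, hyx, hc⟩ := exists_inDisk_opp hρ hx hte h1
  refine main (!s) y z' hy (hyx.trans hxq) ?_
  change _ ≤ ‖A.coord (opp (e, s)) z'‖
  have hw0 : 0 < ‖A.coord (e, s) z‖ := (div_nonneg (norm_nonneg _) hρ.le).trans_lt h1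
  rw [hc, norm_div, le_div_iff₀ hw0]
  have := Real.mul_self_sqrt (norm_nonneg (t e))
  nlinarith [Real.sqrt_nonneg ‖t e‖]

end RegularDifferential

end AdmissibleCoordinates

end OpeningNodes

theorem mainTheorem7 (k : ℕ) (ρ c₁ c₂ : ℝ) (hρ : 0 < ρ) (hc₁ : 0 < c₁) (hc₂ : 0 < c₂) :
    ∃ C : ℝ, 0 < C ∧ ∃ δ : ℝ, 0 < δ ∧
      ∀ (V : Type u) (E : Type w) (Γ : OpeningNodes.OrientedMultigraph V E), Γ.DegreeLE k →
      ∀ (A : OpeningNodes.AdmissibleCoordinates Γ ρ c₁ c₂)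
        (t : lp (fun _ : E => ℂ) ⊤), (∀ e, ‖t e‖ < ρ ^ 2) → ‖t‖ < δ →
      ∀ η : ℝ, 0 < η → η ≤ ρ * c₁ →
      ∀ (ω : A.RegularDifferential t), ω.FiniteNorm η →
      ∀ (α : lp (fun _ : E => ℂ) ⊤), (∀ e, ω.period e = α e) →
        -- `C` is a constant for the estimates of `ω` on the necks ...
        (∀ e : E,
          (∀ z ∈ (A.coord (e, true)).source, z ≠ A.p (e, true) →
            Real.sqrt ‖t e‖ ≤ ‖A.coord (e, true) z‖ →
            ‖2 * Real.pi * Complex.I * ω.f (Γ.tgt e) z - α e / (z - A.p (e, true))‖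
              ≤ C * ‖α‖) ∧
          (∀ z ∈ (A.coord (e, false)).source, z ≠ A.p (e, false) →
            Real.sqrt ‖t e‖ ≤ ‖A.coord (e, false) z‖ →
            ‖2 * Real.pi * Complex.I * ω.f (Γ.src e) z + α e / (z - A.p (e, false))‖
              ≤ C * ‖α‖)) ∧
        -- ... and with the same `C`, there are no zeros on the necks.
        (∀ ε : ℝ, 0 < ε → ε < c₁ * ρ → ∀ e : E, C * ε * ‖α‖ < ‖α e‖ →
          ω.zeros ∩ A.neckAnnulus t e ε = ∅) := by
  obtain ⟨r, T, N⟩ := OpeningNodes.exists_neckConstants k hρ hc₁ hc₂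
  have hB := N.neckBound_nonneg
  -- The summand 1 makes the constant positive: `neckBound` is 0 when k = 0.
  refine ⟨OpeningNodes.neckBound k c₁ c₂ r T + 1, by linarith, T, N.T_pos, ?_⟩
  intro V E Γ hΓ A t _ htT η _ hη ω hω α hα
  have ht : ∀ e, ‖t e‖ ≤ T := fun e => (lp.norm_apply_le_norm (by simp) t e).trans htT.le
  have hαle : ∀ e, ‖α e‖ ≤ ‖α‖ := fun e => lp.norm_apply_le_norm (by simp) α e
  have ha : ∀ e, ‖ω.period e‖ ≤ ‖α‖ := fun e => hα e ▸ hαle e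
  have hα0 : 0 ≤ ‖α‖ := norm_nonneg α
  refine ⟨fun e => ⟨fun z hz hzp hzt => ?_, fun z hz hzp hzt => ?_⟩, fun ε hε _ e he => ?_⟩
  · have key := hω.norm_sub_le hΓ N ht hη ha hz hzp hzt
    simp only [OpeningNodes.sign, cond_true, one_mul, hα] at key
    exact key.trans (mul_le_mul_of_nonneg_right (by linarith) hα0)
  · have key := hω.norm_sub_le hΓ N ht hη ha hz hzp hzt
    simp only [OpeningNodes.sign, cond_false, neg_one_mul, hα, neg_div, sub_neg_eq_add] at key
    exact key.trans (mul_le_mul_of_nonneg_right (by linarith) hα0)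
  · refine hω.zeros_inter_neckAnnulus_eq_empty hΓ N ht hη ha ?_
    rw [hα]
    refine lt_of_le_of_lt ?_ he
    gcongr
    linarith
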